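/- **Conventions.** Let $A$ be an associative unital algebra over $\mathbb{Q}$ (not necessarily commutative), with unit $I$. "Functions" of the odd-numbered variables $\mathbf{t}_o=(t_1,t_3,t_5,\ldots)$ are formal power series in these (mutually commuting, central) variables with coefficients in $A$, and $\lambda$ is an indeterminate. Write $f_{2[\lambda]}(\mathbf{t}_o)=f(\mathbf{t}_o+2[\lambda])$ with $[\lambda]=(\lambda,\lambda^3/3,\lambda^5/5,\ldots)$, expanded in powers of $\lambda$; subscripts $t_n$ denote partial derivatives, $[a,b]=ab-ba$ and $\{a,b\}=ab+ba$. Let $\tilde\xi(\mathbf{t}_o,z)=\sum_{n\ge1}t_{2n-1}z^{2n-1}$ and $$\psi(\mathbf{t}_o,z)=w(\mathbf{t}_o,z)\,e^{\tilde\xi(\mathbf{t}_o,z)},\quad \tilde\psi(\mathbf{t}_o,z)=\tilde w(\mathbf{t}_o,z)\,e^{-\tilde\xi(\mathbf{t}_o,z)},\quad w=I+\sum_{n\ge1}w_n(\mathbf{t}_o)z^{-n},\quad \tilde w=I+\sum_{n\ge1}\tilde w_n(\mathbf{t}_o)z^{-n},$$ understood as formal series in $z$, infinite in both directions, whose coefficients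 are functions of $\mathbf{t}_o$. Let $\mathrm{res}$ denote the coefficient of $z^{-1}$. **Theorem 3.1.** Suppose that, for independent families of variables $\mathbf{s}_o$ and $\mathbf{t}_o$, the odd KP bilinear identity $\mathrm{res}\,[\psi(\mathbf{s}_o,z)\,\tilde\psi(\mathbf{t}_o,z)]=0$ holds. Put $\phi:=-w_1$ and define $\tilde\theta$ by $w_2=-\tilde\theta+\tfrac12(\phi_{t_1}+\phi^2)$. Then the power series $F(\lambda):=I-\frac{\lambda}{2}(\phi_{2[\lambda]}-\phi)$ in $\lambda$ is invertible, and (coefficientwise in $z$) $$\frac1\lambda F(\lambda)(\psi_{2[\lambda]}-\psi)-(\psi_{2[\lambda]}+\psi)_{t_1}=\frac{\lambda}{2}\Big(\tilde\theta_{2[\lambda]}-\tilde\theta+\frac12(\phi_{2[\lambda]}-\phi)_{t_1}-\frac12[\phi,\phi_{2[\lambda]}]\Big)F(\lambda)^{-1}(\psi_{2[\lambda]}+\psi).\qquad(*)$$ Moreover, the expansion of $(*)$ in powers of $\lambda$ recovers the linear system of the odd KP system: whenever functions $\phi,\tilde\theta,\psi$ of $\mathbf{t}_o$ satisfy $(*)$,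 then $$\psi_{t_3}=\Big(\partial^3+3\phi_{t_1}\partial+\tfrac32\big(2\tilde\theta_{t_1}+\phi_{t_1t_1}+[\phi_{t_1},\phi]\big)\Big)\psi,$$ $$\begin{aligned}\psi_{t_5}=\Big(&\partial^5+5\phi_{t_1}\partial^3+\tfrac52(2\tilde\theta_{t_1}+3\phi_{t_1t_1}+[\phi_{t_1},\phi])\partial^2+\tfrac56\big(6\tilde\theta_{t_1t_1}+7\phi_{t_1t_1t_1}+2\phi_{t_3}+6\phi_{t_1}^2+3[\phi_{t_1t_1},\phi]\big)\partial\\&+\tfrac53\big(\tilde\theta_{t_3}+2\tilde\theta_{t_1t_1t_1}+\phi_{t_1t_1t_1t_1}+\tfrac12\phi_{t_1t_3}\big)+5\{\tilde\theta_{t_1},\phi_{t_1}\}+\tfrac52(\phi_{t_1}^2)_{t_1}\\&+\tfrac56[\phi_{t_3},\phi]+\tfrac53[\phi_{t_1t_1t_1},\phi]+\tfrac52[\phi_{t_1}^2,\phi]\Big)\psi,\end{aligned}$$ where $\partial=\partial/\partial t_1$. Furthermore, if $\theta$ and $J$ are functions with $\tilde\theta_{t_1}=\theta_{t_1}+\frac12[\phi,\phi_{t_1}]$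 and $\theta_{t_3}=\tilde\theta_{t_3}-\frac12[\phi,\phi_{t_3}]-J$ (that is, $\tilde\theta=\theta+\frac12\int[\phi,\phi_{t_1}]\,dt_1$ and $J=\int[\phi_{t_3},\phi_{t_1}]\,dt_1$ with compatible constants of integration), then $$\psi_{t_3}=\Big(\partial^3+3\phi_{t_1}\partial+3\theta_{t_1}+\tfrac32\phi_{t_1t_1}\Big)\psi,$$ $$\begin{aligned}\psi_{t_5}=\Big(&\partial^5+5\phi_{t_1}\partial^3+5(\theta_{t_1}+\tfrac32\phi_{t_1t_1})\partial^2+5\big(\theta_{t_1t_1}+\tfrac13\phi_{t_3}+\tfrac76\phi_{t_1t_1t_1}+\phi_{t_1}^2\big)\partial+\tfrac53\theta_{t_3}+\tfrac{10}3\theta_{t_1t_1t_1}\\&+\tfrac56\phi_{t_1t_3}+\tfrac53\phi_{t_1t_1t_1t_1}+5\{\theta_{t_1},\phi_{t_1}\}+\tfrac52(\phi_{t_1}^2)_{t_1}+\tfrac53[\phi_{t_1},\phi_{t_1t_1}]+\tfrac53J\Big)\psi.\end{aligned}$$ -/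

import Mathlib

namespace OddKP

/-- Functions of the odd-numbered variables `𝐭ₒ = (t₁, t₃, t₅, …)` with values in the (not
necessarily commutative) algebra `A`: formal power series with coefficients in `A` in the variables
`t_{2i+1}`, `i : ℕ`, which commute with each other and with `A`. -/
abbrev OddSeries (A : Type*) := MvPowerSeries ℕ A

/-- The weight `∑ᵢ (2i+1) αᵢ` of a multi-index; `∏ᵢ (t_{2i+1} z^{2i+1})^{αᵢ} = 𝐭ₒ^α z^{wt α}`. -/
noncomputable def wt : (ℕ →₀ ℕ) →+ ℕ := Finsupp.weight (fun i : ℕ => 2 * i + 1)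

/-- The finite set of the multi-indices of weight `k`. -/
noncomputable def multiIndices (k : ℕ) : Finset (ℕ →₀ ℕ) :=
  ((Finset.range k).finsupp (fun _ => Finset.range (k + 1))).filter (fun α => wt α = k)

theorem le_wt (α : ℕ →₀ ℕ) (i : ℕ) (hi : α i ≠ 0) : i < wt α ∧ α i ≤ wt α := by
  have h : (2 * i + 1) * α i ≤ wt α := by
    unfold wt
    rw [Finsupp.weight_apply, Finsupp.sum]
    have := Finset.single_le_sum (s := α.support) (f := fun j => α j • (2 * j + 1))
      (fun _ _ => Nat.zero_le _) (Finsupp.mem_support_iff.mpr hi)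
    simpa [mul_comm] using this
  have h1 : 1 ≤ α i := Nat.one_le_iff_ne_zero.mpr hi
  constructor <;> nlinarith

theorem mem_multiIndices {k : ℕ} {α : ℕ →₀ ℕ} : α ∈ multiIndices k ↔ wt α = k := by
  unfold multiIndices
  rw [Finset.mem_filter, Finset.mem_finsupp_iff]
  refine ⟨fun h => h.2, fun h => ⟨⟨?_, ?_⟩, h⟩⟩
  · intro i hi
    have := (le_wt α i (Finsupp.mem_support_iff.mp hi)).1
    exact Finset.mem_range.mpr (by omega)
  · intro i hi
    refine Finset.mem_range.mpr ?_
    by_cases h0 : α i = 0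
    · omega
    · have := (le_wt α i h0).2
      omega

/-- The series `∑_β a_β 𝐭ₒ^β` with given coefficients. -/
def ofCoeff {A : Type*} (a : (ℕ →₀ ℕ) → A) : OddSeries A := a

theorem coeff_ofCoeff {A : Type*} [Semiring A] (a : (ℕ →₀ ℕ) → A) (β : ℕ →₀ ℕ) :
    MvPowerSeries.coeff β (ofCoeff a) = a β := rfl

section Ring

variable {A : Type*} [Ring A] [Algebra ℚ A]

/-- The partial derivative with respect to `t_{2i+1}`: `pd 0 = ∂/∂t₁`, `pd 1 = ∂/∂t₃`,
`pd 2 = ∂/∂t₅`. -/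
noncomputable def pd (i : ℕ) (f : OddSeries A) : OddSeries A := MvPowerSeries.pderivFun i f

/-! ### Baker-Akhiezer functions and the bilinear identity

A formal series `∑_{n ∈ ℤ} fₙ z^n`, infinite in both directions, with coefficients that are formal
power series in `𝐭ₒ`, is given by the function `n ↦ fₙ`. -/

/-- The series `w(𝐭ₒ,z) = ∑_{k ≥ 0} wₖ(𝐭ₒ) z^{-k}`. -/
noncomputable def dressing (w : ℕ → OddSeries A) (n : ℤ) : OddSeries A :=
  if n ≤ 0 then w (-n).toNat else 0

/-- `expCoeff ε α` is the coefficient of `𝐭ₒ^α` in `exp (ε ξ̃(𝐭ₒ,z))`, where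
`ξ̃(𝐭ₒ,z) = ∑ᵢ t_{2i+1} z^{2i+1}`, apart from the factor `z^{wt α}` that goes with it. That is,
`exp (ε ξ̃(𝐭ₒ,z)) = ∑_α (∏ᵢ ε^{αᵢ} / αᵢ!) 𝐭ₒ^α z^{wt α}`. -/
noncomputable def expCoeff (ε : ℚ) (α : ℕ →₀ ℕ) : ℚ :=
  α.prod fun _ a => ε ^ a / (a.factorial : ℚ)

/-- The product `w(𝐭ₒ,z) exp (ε ξ̃(𝐭ₒ,z))`, as a series in `z` infinite in both directions: the
coefficient of `𝐭ₒ^β z^n` is the sum, over all `γ + α = β`, of the coefficient of `𝐭ₒ^γ z^{n - wt α}`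
in `w(𝐭ₒ,z)` times that of `𝐭ₒ^α z^{wt α}` in the exponential. -/
noncomputable def mulExp (ε : ℚ) (w : ℕ → OddSeries A) (n : ℤ) : OddSeries A := ofCoeff fun β =>
  ∑ p ∈ Finset.HasAntidiagonal.antidiagonal β,
    expCoeff ε p.2 • MvPowerSeries.coeff p.1 (dressing w (n - (wt p.2 : ℤ)))

/-- The Baker-Akhiezer function `ψ(𝐭ₒ,z) = w(𝐭ₒ,z) e^{ξ̃(𝐭ₒ,z)}`. -/
noncomputable def psi (w : ℕ → OddSeries A) : ℤ → OddSeries A := mulExp 1 w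

/-- The adjoint function `ψ̃(𝐭ₒ,z) = w̃(𝐭ₒ,z) e^{-ξ̃(𝐭ₒ,z)}`. -/
noncomputable def psiTilde (w' : ℕ → OddSeries A) : ℤ → OddSeries A := mulExp (-1) w'

/-- The residue (the coefficient of `z^{-1}`) of `f(𝐬ₒ,z) g(𝐭ₒ,z)`, a formal power series in two
independent families of variables, `𝐬ₒ` (left summand) and `𝐭ₒ` (right summand). The coefficient of
`𝐬ₒ^β 𝐭ₒ^γ z^{-1}` is `∑_{i + j = -1} f_{i,β} g_{j,γ}`. -/
noncomputable def residue (f g : ℤ → OddSeries A) : MvPowerSeries (ℕ ⊕ ℕ) A := fun δ =>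
  ∑ᶠ i : ℤ,
    MvPowerSeries.coeff (Finsupp.sumFinsuppEquivProdFinsupp δ).1 (f i) *
      MvPowerSeries.coeff (Finsupp.sumFinsuppEquivProdFinsupp δ).2 (g (-1 - i))

theorem wt_le_of_mem_antidiagonal {β : ℕ →₀ ℕ} {p : (ℕ →₀ ℕ) × (ℕ →₀ ℕ)}
    (hp : p ∈ Finset.HasAntidiagonal.antidiagonal β) : wt p.2 ≤ wt β := by
  rw [← Finset.HasAntidiagonal.mem_antidiagonal.mp hp, map_add]
  omega

theorem coeff_mulExp_of_lt (ε : ℚ) (w : ℕ → OddSeries A) (n : ℤ) (β : ℕ →₀ ℕ)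
    (h : (wt β : ℤ) < n) : MvPowerSeries.coeff β (mulExp ε w n) = 0 := by
  rw [mulExp, coeff_ofCoeff]
  refine Finset.sum_eq_zero fun p hp => ?_
  have := wt_le_of_mem_antidiagonal hp
  rw [dressing, if_neg (by omega), map_zero, smul_zero]

/-- The sums that define `residue (psi w) (psiTilde w')` are finite. -/
theorem residue_support_finite (w w' : ℕ → OddSeries A) (β γ : ℕ →₀ ℕ) :
    (Function.support fun i : ℤ => MvPowerSeries.coeff β (psi w i) *
      MvPowerSeries.coeff γ (psiTilde w' (-1 - i))).Finite := by
  refine (Set.finite_Icc (-1 - (wt γ : ℤ)) (wt β : ℤ)).subset fun i hi => ?_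
  rw [Function.mem_support] at hi
  refine ⟨?_, ?_⟩ <;> by_contra h <;> apply hi
  · rw [psiTilde, coeff_mulExp_of_lt _ _ _ γ (by omega), mul_zero]
  · rw [psi, coeff_mulExp_of_lt _ _ _ β (by omega), zero_mul]

/-! ### The dependent variables -/

/-- `φ = -w₁`. -/
noncomputable def phi (w : ℕ → OddSeries A) : OddSeries A := -w 1

/-- The variable `θ̃` determined by `w₂ = -θ̃ + (φ_{t₁} + φ²) / 2`. -/
noncomputable def thetaTilde (w : ℕ → OddSeries A) : OddSeries A :=
  -w 2 + (1 / 2 : ℚ) • (pd 0 (phi w) + phi w ^ 2)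

/-! ### The functional linear equation

Its two sides are formal power series in the indeterminate `λ` (`PowerSeries.X`), with coefficients
in `OddSeries A`; a function of `𝐭ₒ` alone is embedded by `PowerSeries.C`. -/

/-- The Miwa shift `f_{c[λ]}(𝐭ₒ) = f(𝐭ₒ + c[λ])`, `[λ] = (λ, λ³/3, λ⁵/5, …)`, expanded in powers of
`λ`. By the binomial theorem the coefficient of `𝐭ₒ^β λ^k` is the sum over the multi-indices `α` of
weight `k` of `∏ᵢ binom(βᵢ + αᵢ, αᵢ) (c / (2i+1))^{αᵢ}` times the coefficient of `𝐭ₒ^{β+α}` in `f`. -/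
noncomputable def miwaShift (c : ℚ) (f : OddSeries A) : PowerSeries (OddSeries A) :=
  PowerSeries.mk fun k => ofCoeff fun β =>
    ∑ α ∈ multiIndices k,
      (α.prod fun i a => ((β i + a).choose a : ℚ) * (c / (2 * (i : ℚ) + 1)) ^ a) •
        MvPowerSeries.coeff (β + α) f

/-- The derivative with respect to `t₁` of a power series in `λ`. -/
noncomputable def pdt1 (f : PowerSeries (OddSeries A)) : PowerSeries (OddSeries A) :=
  PowerSeries.mk fun k => pd 0 (PowerSeries.coeff k f)

/-- The quotient `λ⁻¹ f` of a power series in `λ` without constant term. -/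
noncomputable def divLambda (f : PowerSeries (OddSeries A)) : PowerSeries (OddSeries A) :=
  PowerSeries.mk fun k => PowerSeries.coeff (k + 1) f

theorem lambda_mul_divLambda {B : Type*} [Ring B] (f : PowerSeries (OddSeries B))
    (h : PowerSeries.constantCoeff f = 0) : PowerSeries.X * divLambda f = f := by
  ext1 k
  cases k with
  | zero => simpa using h.symm
  | succ k => rw [PowerSeries.coeff_succ_X_mul, divLambda, PowerSeries.coeff_mk]

theorem constantCoeff_miwaShift (c : ℚ) (f : OddSeries A) :
    PowerSeries.constantCoeff (miwaShift c f) = f := by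
  have h : multiIndices 0 = {0} := by
    ext α
    rw [mem_multiIndices, Finset.mem_singleton]
    refine ⟨fun h => ?_, fun h => by rw [h, map_zero]⟩
    ext i
    by_contra hi
    have := (le_wt α i hi).1
    omega
  rw [← PowerSeries.coeff_zero_eq_constantCoeff_apply, miwaShift, PowerSeries.coeff_mk]
  ext β
  rw [coeff_ofCoeff, h, Finset.sum_singleton]
  simp

/-- `F(λ) = I - (λ/2) (φ_{2[λ]} - φ)`. -/
noncomputable def F (φ : OddSeries A) : PowerSeries (OddSeries A) :=
  1 - (1 / 2 : ℚ) • (PowerSeries.X * (miwaShift 2 φ - PowerSeries.C φ))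

/-- The functional linear equation
`λ⁻¹ F(λ) (ψ_{2[λ]} - ψ) - (ψ_{2[λ]} + ψ)_{t₁} =
  (λ/2) (θ̃_{2[λ]} - θ̃ + (φ_{2[λ]} - φ)_{t₁} / 2 - [φ, φ_{2[λ]}] / 2) F(λ)⁻¹ (ψ_{2[λ]} + ψ)`. -/
def FunctionalLinearEquation (φ θt ψ : OddSeries A) : Prop :=
  divLambda (F φ * (miwaShift 2 ψ - PowerSeries.C ψ))
      - pdt1 (miwaShift 2 ψ + PowerSeries.C ψ) =
    (1 / 2 : ℚ) • (PowerSeries.X *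
      ((miwaShift 2 θt - PowerSeries.C θt)
        + (1 / 2 : ℚ) • pdt1 (miwaShift 2 φ - PowerSeries.C φ)
        - (1 / 2 : ℚ) • ⁅PowerSeries.C φ, miwaShift 2 φ⁆) *
      Ring.inverse (F φ) * (miwaShift 2 ψ + PowerSeries.C ψ))

/-! ### The linear system of the odd KP system -/

/-- The linear system of the odd KP system in terms of `φ` and `θ̃`. -/
def LinearSystemTilde (φ θt ψ : OddSeries A) : Prop :=
  pd 1 ψ = pd 0 (pd 0 (pd 0 ψ)) + (3 : ℚ) • (pd 0 φ * pd 0 ψ)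
      + (3 / 2 : ℚ) • (((2 : ℚ) • pd 0 θt + pd 0 (pd 0 φ) + ⁅pd 0 φ, φ⁆) * ψ) ∧
  pd 2 ψ = pd 0 (pd 0 (pd 0 (pd 0 (pd 0 ψ))))
      + (5 : ℚ) • (pd 0 φ * pd 0 (pd 0 (pd 0 ψ)))
      + (5 / 2 : ℚ) • (((2 : ℚ) • pd 0 θt + (3 : ℚ) • pd 0 (pd 0 φ) + ⁅pd 0 φ, φ⁆)
          * pd 0 (pd 0 ψ))
      + (5 / 6 : ℚ) • (((6 : ℚ) • pd 0 (pd 0 θt) + (7 : ℚ) • pd 0 (pd 0 (pd 0 φ))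
          + (2 : ℚ) • pd 1 φ + (6 : ℚ) • (pd 0 φ) ^ 2 + (3 : ℚ) • ⁅pd 0 (pd 0 φ), φ⁆) * pd 0 ψ)
      + ((5 / 3 : ℚ) • (pd 1 θt + (2 : ℚ) • pd 0 (pd 0 (pd 0 θt))
            + pd 0 (pd 0 (pd 0 (pd 0 φ))) + (1 / 2 : ℚ) • pd 0 (pd 1 φ))
          + (5 : ℚ) • (pd 0 θt * pd 0 φ + pd 0 φ * pd 0 θt)
          + (5 / 2 : ℚ) • pd 0 ((pd 0 φ) ^ 2)
          + (5 / 6 : ℚ) • ⁅pd 1 φ, φ⁆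
          + (5 / 3 : ℚ) • ⁅pd 0 (pd 0 (pd 0 φ)), φ⁆
          + (5 / 2 : ℚ) • ⁅(pd 0 φ) ^ 2, φ⁆) * ψ

/-- The linear system of the odd KP system in terms of `φ` and `θ`, where `J` stands for the
integral `∫ [φ_{t₃}, φ_{t₁}] dt₁`. -/
def LinearSystem (φ θ J ψ : OddSeries A) : Prop :=
  pd 1 ψ = pd 0 (pd 0 (pd 0 ψ)) + (3 : ℚ) • (pd 0 φ * pd 0 ψ)
      + ((3 : ℚ) • pd 0 θ + (3 / 2 : ℚ) • pd 0 (pd 0 φ)) * ψ ∧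
  pd 2 ψ = pd 0 (pd 0 (pd 0 (pd 0 (pd 0 ψ))))
      + (5 : ℚ) • (pd 0 φ * pd 0 (pd 0 (pd 0 ψ)))
      + (5 : ℚ) • ((pd 0 θ + (3 / 2 : ℚ) • pd 0 (pd 0 φ)) * pd 0 (pd 0 ψ))
      + (5 : ℚ) • ((pd 0 (pd 0 θ) + (1 / 3 : ℚ) • pd 1 φ
          + (7 / 6 : ℚ) • pd 0 (pd 0 (pd 0 φ)) + (pd 0 φ) ^ 2) * pd 0 ψ)
      + ((5 / 3 : ℚ) • pd 1 θ + (10 / 3 : ℚ) • pd 0 (pd 0 (pd 0 θ))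
          + (5 / 6 : ℚ) • pd 0 (pd 1 φ) + (5 / 3 : ℚ) • pd 0 (pd 0 (pd 0 (pd 0 φ)))
          + (5 : ℚ) • (pd 0 θ * pd 0 φ + pd 0 φ * pd 0 θ)
          + (5 / 2 : ℚ) • pd 0 ((pd 0 φ) ^ 2)
          + (5 / 3 : ℚ) • ⁅pd 0 φ, pd 0 (pd 0 φ)⁆
          + (5 / 3 : ℚ) • J) * ψ

/-- `θ` and `J` are related to `φ` and `θ̃` by `θ̃ = θ + ½ ∫ [φ, φ_{t₁}] dt₁` and
`J = ∫ [φ_{t₃}, φ_{t₁}] dt₁`. The constants of integration (functions of `t₃, t₅, …`) of `θ` are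
arbitrary, and those of `J` are fixed by `θ_{t₃} = θ̃_{t₃} - ½ [φ, φ_{t₃}] - J`; then
`J_{t₁} = [φ_{t₃}, φ_{t₁}]` follows. -/
def ThetaRelation (φ θt θ J : OddSeries A) : Prop :=
  pd 0 θt = pd 0 θ + (1 / 2 : ℚ) • ⁅φ, pd 0 φ⁆ ∧
  pd 1 θ = pd 1 θt - (1 / 2 : ℚ) • ⁅φ, pd 1 φ⁆ - J

end Ring

end OddKP

/-! The set of series `f` with res[`f`(𝐬ₒ,z) ψ̃(𝐭ₒ,z)] = 0 contains ψ and is stable under left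
multiplication by functions of 𝐬ₒ, derivatives in 𝐬ₒ and Miwa shifts in 𝐬ₒ. Hence it contains the
difference of the two sides of (*). An element `l` e^ξ̃ of this set with `l` = O(z⁻¹) is zero
(`eq_zero_of_isOrthogonal`), so it remains to control the growth of that difference in z.

Since exp(2 ∑ xⁿ/n), over odd n, equals (1 + x)/(1 - x), the shift turns w e^ξ̃ into w_{2[λ]} (1 +
λz)/(1 - λz) e^ξ̃ (`miwaShift_expMul`). After the denominator 1 - λz is cleared, only the
coefficients of z¹ and z⁰ could survive among the nonnegative powers. The first vanishes by the
choice of F, the second by the choice of the potential on the right of (*)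
(`dressing_cancellation`). Growth O(z⁻¹)/(1 - λz) still forces vanishing, by induction on the order
in λ (`eq_zero_of_isOrthogonalSeries`).

Properties of the Miwa shift come from the differential equation λ∂_λ f = c ∑ λ^{2i+1} ∂f/∂t_{2i+1},
whose solutions are determined by their constant term (`IsFlow.eq`). The same equation yields the
Taylor coefficients through λ⁵. The linear system is then read off from the coefficients of λ² and
λ⁴ in (*). -/

namespace OddKP

open Finset hiding antidiagonal mem_antidiagonal
open Finset.HasAntidiagonal (antidiagonal mem_antidiagonal)
open Finsupp (single)

/-! ### Partial derivatives and the Leibniz rule -/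

section PartialDerivatives

variable {A : Type*} [Ring A] [Algebra ℚ A]

theorem coeff_pd (i : ℕ) (f : OddSeries A) (β : ℕ →₀ ℕ) :
    MvPowerSeries.coeff β (pd i f) =
      ((β i : ℚ) + 1) • MvPowerSeries.coeff (β + single i 1) f := by
  rw [pd, MvPowerSeries.coeff_pderivFun, Algebra.smul_def, map_add, map_natCast, map_one,
    ← Nat.cast_succ, Nat.cast_comm]

theorem coeff_rat_smul (q : ℚ) (f : OddSeries A) (β : ℕ →₀ ℕ) :
    MvPowerSeries.coeff β (q • f) = q • MvPowerSeries.coeff β f := rfl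

/-- The partial derivative with respect to `t_{2i+1}` as a linear map. -/
noncomputable def pdLin (i : ℕ) : OddSeries A →ₗ[ℚ] OddSeries A where
  toFun := pd i
  map_add' := MvPowerSeries.pderivFun_add
  map_smul' q f := by
    ext β
    simp only [coeff_pd, coeff_rat_smul, RingHom.id_apply]
    rw [smul_comm]

theorem pd_add (i : ℕ) (f g : OddSeries A) : pd i (f + g) = pd i f + pd i g :=
  map_add (pdLin i) f g

theorem pd_sub (i : ℕ) (f g : OddSeries A) : pd i (f - g) = pd i f - pd i g :=
  map_sub (pdLin i) f g

theorem pd_zero (i : ℕ) : pd i (0 : OddSeries A) = 0 := map_zero (pdLin i)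

theorem pd_smul (i : ℕ) (q : ℚ) (f : OddSeries A) : pd i (q • f) = q • pd i f :=
  map_smul (pdLin i) q f

theorem pd_one {B : Type*} [Ring B] (i : ℕ) : pd i (1 : OddSeries B) = 0 :=
  MvPowerSeries.pderivFun_one

theorem pd_sum {ι : Type*} (i : ℕ) (s : Finset ι) (f : ι → OddSeries A) :
    pd i (∑ j ∈ s, f j) = ∑ j ∈ s, pd i (f j) := map_sum (pdLin i) f s

theorem pd_comm (i j : ℕ) (f : OddSeries A) : pd i (pd j f) = pd j (pd i f) := by
  ext β
  simp only [coeff_pd, smul_smul]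
  rw [add_right_comm]
  congr 1
  by_cases h : i = j
  · rw [h]
  · simp [h, Ne.symm h, mul_comm]

/-- Reindexing by p ↦ (p.1 + eᵢ, p.2). The pairs that are not reached have p.1 i = 0, so their
weight is zero. -/
theorem sum_antidiagonal_fst_smul {M : Type*} [AddCommGroup M] [Module ℚ M] (i : ℕ)
    (β : ℕ →₀ ℕ) (h : (ℕ →₀ ℕ) → (ℕ →₀ ℕ) → M) :
    ∑ p ∈ antidiagonal β, ((p.1 : ℕ →₀ ℕ) i + 1 : ℚ) • h (p.1 + single i 1) p.2 =
      ∑ p ∈ antidiagonal (β + single i 1), ((p.1 : ℕ →₀ ℕ) i : ℚ) • h p.1 p.2 := by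
  refine Finset.sum_of_injOn (fun p => (p.1 + single i 1, p.2)) ?_ ?_ ?_ ?_
  · rintro ⟨a, b⟩ _ ⟨c, d⟩ _ h
    simpa using h
  · rintro ⟨a, b⟩ h
    simp only [mem_coe, mem_antidiagonal] at h ⊢
    rw [← h, add_right_comm]
  · rintro ⟨a, b⟩ h hn
    by_cases h0 : a i = 0
    · simp [h0]
    exfalso
    apply hn
    have hle : single i 1 ≤ a := by
      rw [Finsupp.single_le_iff]; omega
    refine ⟨(a - single i 1, b), ?_, ?_⟩
    · simp only [mem_coe, mem_antidiagonal] at h ⊢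
      apply add_right_cancel (b := single i 1)
      rw [add_right_comm, tsub_add_cancel_of_le hle, h]
    · simp only [tsub_add_cancel_of_le hle]
  · rintro ⟨a, b⟩ _
    simp

/-- The Leibniz rule for convolutions. -/
theorem sum_antidiagonal_add_single {M : Type*} [AddCommGroup M] [Module ℚ M] (i : ℕ)
    (β : ℕ →₀ ℕ) (h : (ℕ →₀ ℕ) → (ℕ →₀ ℕ) → M) :
    ((β i : ℚ) + 1) • ∑ p ∈ antidiagonal (β + single i 1), h p.1 p.2 =
      ∑ p ∈ antidiagonal β, ((p.1 : ℕ →₀ ℕ) i + 1 : ℚ) • h (p.1 + single i 1) p.2 +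
      ∑ p ∈ antidiagonal β, ((p.2 : ℕ →₀ ℕ) i + 1 : ℚ) • h p.1 (p.2 + single i 1) := by
  have h2 : ∑ p ∈ antidiagonal β, ((p.2 : ℕ →₀ ℕ) i + 1 : ℚ) • h p.1 (p.2 + single i 1) =
      ∑ p ∈ antidiagonal (β + single i 1), ((p.2 : ℕ →₀ ℕ) i : ℚ) • h p.1 p.2 := by
    have := sum_antidiagonal_fst_smul i β fun p q => h q p
    rwa [Finsupp.sum_antidiagonal_swap _ fun p q => ((p i : ℚ) + 1) • h q (p + single i 1),
      Finsupp.sum_antidiagonal_swap _ fun p q => (p i : ℚ) • h q p] at this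
  rw [sum_antidiagonal_fst_smul, h2, ← sum_add_distrib, smul_sum]
  refine sum_congr rfl fun p hp => ?_
  rw [← add_smul]
  congr 1
  have := congrArg (fun f => f i) (mem_antidiagonal.mp hp)
  simp only [Finsupp.add_apply, Finsupp.single_eq_same] at this
  exact_mod_cast this.symm

theorem pd_mul (i : ℕ) (f g : OddSeries A) : pd i (f * g) = pd i f * g + f * pd i g := by
  ext β
  rw [coeff_pd, map_add, MvPowerSeries.coeff_mul, MvPowerSeries.coeff_mul,
    MvPowerSeries.coeff_mul, sum_antidiagonal_add_single i β
      (fun p q => MvPowerSeries.coeff p f * MvPowerSeries.coeff q g)]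
  simp only [coeff_pd, smul_mul_assoc, mul_smul_comm]

end PartialDerivatives

/-! ### Multiplication by the exponential factor -/

section ExponentialFactor

variable {A : Type*} [Ring A] [Algebra ℚ A]

theorem wt_single (i a : ℕ) : wt (single i a) = a * (2 * i + 1) := by
  simp [wt, Finsupp.weight_single]

theorem wt_eq_zero {α : ℕ →₀ ℕ} (h : wt α = 0) : α = 0 := by
  ext i
  by_contra hi
  have := (le_wt α i hi).1
  omega

theorem expCoeff_zero (ε : ℚ) : expCoeff ε 0 = 1 := by simp [expCoeff]

theorem prod_add_single {c : ℕ → ℕ → ℚ} (hc : ∀ j, c j 0 = 1) (α : ℕ →₀ ℕ) (i : ℕ) :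
    (α + single i 1).prod c * c i (α i) = α.prod c * c i (α i + 1) := by
  have h1 : (α + single i 1).prod c = c i (α i + 1) * (α.erase i).prod c := by
    rw [← Finsupp.mul_prod_erase' (α + single i 1) i c (fun j => hc j)]
    congr 2
    · simp
    · simp [Finsupp.erase_add]
  rw [h1, ← Finsupp.mul_prod_erase' α i c (fun j => hc j)]
  ring

theorem expCoeff_add_single (ε : ℚ) (α : ℕ →₀ ℕ) (i : ℕ) :
    ((α i : ℚ) + 1) * expCoeff ε (α + single i 1) = ε * expCoeff ε α := by
  have h := prod_add_single (c := fun _ a => ε ^ a / (a.factorial : ℚ)) (by simp) α i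
  -- The factor at `i` is cancelled below, which requires ε ≠ 0. For ε = 0 both sides vanish, the
  -- left one through the factor at `i`.
  by_cases hε : ε = 0
  · subst hε
    rw [zero_mul, mul_eq_zero]
    right
    rw [expCoeff, Finsupp.prod]
    refine Finset.prod_eq_zero (i := i) ?_ ?_ <;> simp
  have h1 : ε ^ α i / ((α i).factorial : ℚ) ≠ 0 := by positivity
  apply mul_right_cancel₀ h1
  rw [mul_assoc, expCoeff, h, Nat.factorial_succ, pow_succ, expCoeff]
  push_cast
  field_simp

/-- The product with the exponential `exp (ε ξ̃(𝐭ₒ,z))` of a series in `z` that is infinite in both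
directions. -/
noncomputable def expMul (ε : ℚ) (f : ℤ → OddSeries A) (n : ℤ) : OddSeries A := ofCoeff fun β =>
  ∑ p ∈ antidiagonal β, expCoeff ε p.2 • MvPowerSeries.coeff p.1 (f (n - (wt p.2 : ℤ)))

theorem mulExp_eq_expMul (ε : ℚ) (w : ℕ → OddSeries A) : mulExp ε w = expMul ε (dressing w) := rfl

theorem coeff_expMul (ε : ℚ) (f : ℤ → OddSeries A) (n : ℤ) (β : ℕ →₀ ℕ) :
    MvPowerSeries.coeff β (expMul ε f n) =
      ∑ p ∈ antidiagonal β, expCoeff ε p.2 • MvPowerSeries.coeff p.1 (f (n - (wt p.2 : ℤ))) := rfl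

theorem expMul_add (ε : ℚ) (f g : ℤ → OddSeries A) (n : ℤ) :
    expMul ε (f + g) n = expMul ε f n + expMul ε g n := by
  ext β
  simp [coeff_expMul, sum_add_distrib]

theorem expMul_smul (ε q : ℚ) (f : ℤ → OddSeries A) (n : ℤ) :
    expMul ε (q • f) n = q • expMul ε f n := by
  ext β
  simp only [coeff_expMul, coeff_rat_smul, smul_sum, Pi.smul_apply]
  exact sum_congr rfl fun p _ => smul_comm _ _ _

/-- `expMul` as a linear map. -/
noncomputable def expMulLin (ε : ℚ) : (ℤ → OddSeries A) →ₗ[ℚ] (ℤ → OddSeries A) where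
  toFun := expMul ε
  map_add' f g := funext (expMul_add ε f g)
  map_smul' q f := funext (expMul_smul ε q f)

theorem expMul_sum {ι : Type*} (ε : ℚ) (s : Finset ι) (f : ι → ℤ → OddSeries A) (n : ℤ) :
    expMul ε (∑ j ∈ s, f j) n = ∑ j ∈ s, expMul ε (f j) n := by
  have h : expMul ε (∑ j ∈ s, f j) = ∑ j ∈ s, expMul ε (f j) := map_sum (expMulLin ε) f s
  rw [h, Finset.sum_apply]

theorem expMul_mul_left (ε : ℚ) (g : OddSeries A) (f : ℤ → OddSeries A) (n : ℤ) :
    expMul ε (fun m => g * f m) n = g * expMul ε f n := by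
  ext β
  simp only [coeff_expMul, MvPowerSeries.coeff_mul, smul_sum, mul_sum, Finset.sum_sigma']
  refine Finset.sum_nbij' (fun ⟨⟨_, j⟩, ⟨k, l⟩⟩ ↦ ⟨(k, l + j), (l, j)⟩)
    (fun ⟨⟨i, _⟩, ⟨k, l⟩⟩ ↦ ⟨(i + k, l), (i, k)⟩) ?_ ?_ ?_ ?_ ?_
  all_goals
    rintro ⟨⟨a, b⟩, ⟨c, d⟩⟩ h
    simp only [mem_sigma, mem_antidiagonal] at h ⊢
    obtain ⟨h1, h2⟩ := h
    subst h1
    subst h2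
  · simp [add_assoc]
  · simp [add_assoc]
  · simp
  · simp
  · simp

/-- Differentiating exp(ε ξ̃) in t_{2i+1} brings down ε z^{2i+1}, which lowers the index in z by
2i+1. -/
theorem pd_expMul (ε : ℚ) (i : ℕ) (f : ℤ → OddSeries A) (n : ℤ) :
    pd i (expMul ε f n) =
      expMul ε (fun m => pd i (f m) + ε • f (m - (2 * i + 1 : ℕ))) n := by
  ext β
  rw [coeff_pd, coeff_expMul, coeff_expMul, sum_antidiagonal_add_single i β
    (fun p q => expCoeff ε q • MvPowerSeries.coeff p (f (n - (wt q : ℤ)))), ← sum_add_distrib]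
  refine sum_congr rfl fun p _ => ?_
  rw [map_add (MvPowerSeries.coeff _), coeff_pd, coeff_rat_smul, smul_add, smul_comm]
  congr 1
  rw [smul_smul, expCoeff_add_single, mul_comm ε, mul_smul, map_add, wt_single]
  congr 4
  push_cast
  ring_nf

end ExponentialFactor

/-! ### The flow equation in λ and uniqueness of its solutions -/

section Flows

variable {A : Type*} [Ring A]

/-- The derivative with respect to `t_{2i+1}` of a power series in `λ`. -/
noncomputable def pdSeries (i : ℕ) (f : PowerSeries (OddSeries A)) : PowerSeries (OddSeries A) :=
  PowerSeries.mk fun k => pd i (PowerSeries.coeff k f)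

theorem coeff_pdSeries (i k : ℕ) (f : PowerSeries (OddSeries A)) :
    PowerSeries.coeff k (pdSeries i f) = pd i (PowerSeries.coeff k f) :=
  PowerSeries.coeff_mk _ _

theorem pdt1_eq_pdSeries (f : PowerSeries (OddSeries A)) : pdt1 f = pdSeries 0 f := rfl

variable [Algebra ℚ A]

theorem series_coeff_rat_smul (q : ℚ) (f : PowerSeries (OddSeries A)) (k : ℕ) :
    PowerSeries.coeff k (q • f) = q • PowerSeries.coeff k f := rfl

theorem pdSeries_add (i : ℕ) (f g : PowerSeries (OddSeries A)) :
    pdSeries i (f + g) = pdSeries i f + pdSeries i g := by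
  ext1 k
  simp only [coeff_pdSeries, map_add, pd_add]

theorem pdSeries_sub (i : ℕ) (f g : PowerSeries (OddSeries A)) :
    pdSeries i (f - g) = pdSeries i f - pdSeries i g := by
  ext1 k
  simp only [coeff_pdSeries, map_sub, pd_sub]

theorem pdSeries_zero (i : ℕ) : pdSeries i (0 : PowerSeries (OddSeries A)) = 0 := by
  ext1 k
  simp only [coeff_pdSeries, map_zero, pd_zero]

theorem pdSeries_mul (i : ℕ) (f g : PowerSeries (OddSeries A)) :
    pdSeries i (f * g) = pdSeries i f * g + f * pdSeries i g := by
  ext1 k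
  simp only [coeff_pdSeries, map_add, PowerSeries.coeff_mul, pd_sum, pd_mul, sum_add_distrib]

theorem pdSeries_C (i : ℕ) (f : OddSeries A) :
    pdSeries i (PowerSeries.C f) = PowerSeries.C (pd i f) := by
  ext1 k
  rw [coeff_pdSeries, PowerSeries.coeff_C, PowerSeries.coeff_C]
  split_ifs
  · rfl
  · exact pd_zero i

theorem pdSeries_X_pow_mul (i m : ℕ) (f : PowerSeries (OddSeries A)) :
    pdSeries i (PowerSeries.X ^ m * f) = PowerSeries.X ^ m * pdSeries i f := by
  ext1 k
  simp only [coeff_pdSeries, PowerSeries.coeff_X_pow_mul']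
  split_ifs
  · rfl
  · exact pd_zero i

theorem pdSeries_X_mul (i : ℕ) (f : PowerSeries (OddSeries A)) :
    pdSeries i (PowerSeries.X * f) = PowerSeries.X * pdSeries i f := by
  simpa using pdSeries_X_pow_mul i 1 f

/-- The vector field `∑_{i < N} λ^{2i+1} ∂_{t_{2i+1}}`. -/
noncomputable def flowField (N : ℕ) (f : PowerSeries (OddSeries A)) : PowerSeries (OddSeries A) :=
  ∑ i ∈ range N, PowerSeries.X ^ (2 * i + 1) * pdSeries i f

theorem flowField_mul (N : ℕ) (f g : PowerSeries (OddSeries A)) :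
    flowField N (f * g) = flowField N f * g + f * flowField N g := by
  simp only [flowField, sum_mul, mul_sum, ← sum_add_distrib, pdSeries_mul]
  refine sum_congr rfl fun i _ => ?_
  rw [mul_add, mul_assoc, ← mul_assoc f, (PowerSeries.commute_X_pow f _).eq, mul_assoc]

theorem flowField_pdSeries (N j : ℕ) (f : PowerSeries (OddSeries A)) :
    flowField N (pdSeries j f) = pdSeries j (flowField N f) := by
  ext1 k
  simp only [flowField, coeff_pdSeries, map_sum, pd_sum, PowerSeries.coeff_X_pow_mul']
  refine sum_congr rfl fun i _ => ?_
  split_ifs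
  · rw [pd_comm]
  · exact (pd_zero j).symm

/-- The solutions of `λ ∂_λ f = c ∑ᵢ λ^{2i+1} ∂_{t_{2i+1}} f`. -/
def IsFlow (c : ℚ) (f : PowerSeries (OddSeries A)) : Prop :=
  ∀ N k : ℕ, k ≤ N →
    (k : ℚ) • PowerSeries.coeff k f = c • PowerSeries.coeff k (flowField N f)

/-- Both λ∂_λ and the vector field are derivations. The two factors contribute orders at most k, so
one truncation `N` must serve them all; this is why `IsFlow` asks for every `N` ≥ k. -/
theorem IsFlow.mul {c : ℚ} {f g : PowerSeries (OddSeries A)} (hf : IsFlow c f)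
    (hg : IsFlow c g) : IsFlow c (f * g) := by
  intro N k hk
  rw [flowField_mul, map_add, PowerSeries.coeff_mul, PowerSeries.coeff_mul,
    PowerSeries.coeff_mul, ← sum_add_distrib, smul_sum, smul_sum]
  refine sum_congr rfl fun p hp => ?_
  have h := mem_antidiagonal.mp hp
  have h1 := hf N p.1 (by omega)
  have h2 := hg N p.2 (by omega)
  rw [smul_add, ← smul_mul_assoc c, ← h1, ← mul_smul_comm c, ← h2, smul_mul_assoc,
    mul_smul_comm, ← add_smul, ← h]
  push_cast
  rfl

theorem IsFlow.pdSeries {c : ℚ} {f : PowerSeries (OddSeries A)} (hf : IsFlow c f) (j : ℕ) :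
    IsFlow c (pdSeries j f) := by
  intro N k hk
  rw [flowField_pdSeries, coeff_pdSeries, coeff_pdSeries, ← pd_smul, ← pd_smul, hf N k hk]

/-- A flow is determined by its initial value. -/
theorem IsFlow.eq {c : ℚ} {f g : PowerSeries (OddSeries A)} (hf : IsFlow c f) (hg : IsFlow c g)
    (h : PowerSeries.constantCoeff f = PowerSeries.constantCoeff g) : f = g := by
  ext1 k
  induction k using Nat.strong_induction_on with
  | _ k ih =>
    rcases Nat.eq_zero_or_pos k with rfl | hk
    · simpa using h
    have hk0 : (k : ℚ) ≠ 0 := by positivity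
    -- The vector field carries a factor λ, so its order-k coefficient involves only lower
    -- coefficients of the series. Division by k then closes the recursion.
    have key : (k : ℚ) • PowerSeries.coeff k f = (k : ℚ) • PowerSeries.coeff k g := by
      rw [hf k k le_rfl, hg k k le_rfl]
      congr 1
      simp only [flowField, map_sum, PowerSeries.coeff_X_pow_mul', coeff_pdSeries]
      refine sum_congr rfl fun i _ => ?_
      split_ifs with hi
      · rw [ih _ (by omega)]
      · rfl
    have := congrArg (fun x => (k : ℚ)⁻¹ • x) key
    simpa only [smul_smul, inv_mul_cancel₀ hk0, one_smul] using this

end Flows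

/-! ### The Miwa shift as a flow -/

section MiwaShift

variable {A : Type*} [Ring A] [Algebra ℚ A]

theorem coeff_miwaShift (c : ℚ) (f : OddSeries A) (k : ℕ) (β : ℕ →₀ ℕ) :
    MvPowerSeries.coeff β (PowerSeries.coeff k (miwaShift c f)) =
      ∑ α ∈ multiIndices k,
        (α.prod fun i a => ((β i + a).choose a : ℚ) * (c / (2 * (i : ℚ) + 1)) ^ a) •
          MvPowerSeries.coeff (β + α) f := by
  rw [miwaShift, PowerSeries.coeff_mk, coeff_ofCoeff]

/-- The coefficient of `f_{β+α}` in the Miwa shift. -/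
noncomputable def shiftCoeff (c : ℚ) (β α : ℕ →₀ ℕ) : ℚ :=
  α.prod fun i a => ((β i + a).choose a : ℚ) * (c / (2 * (i : ℚ) + 1)) ^ a

/-- Only the factor at `i` changes, and (a+1) binom(b+a+1, a+1) = (b+1) binom(b+1+a, a). The right
side carries the factor produced by differentiation in t_{2i+1}. -/
theorem shiftCoeff_add_single (c : ℚ) (β α : ℕ →₀ ℕ) (i : ℕ) :
    (2 * (i : ℚ) + 1) * ((α i : ℚ) + 1) * shiftCoeff c β (α + single i 1) =
      c * (((β i : ℚ) + 1) * shiftCoeff c (β + single i 1) α) := by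
  set u : ℕ → ℕ → ℚ := fun i a => ((β i + a).choose a : ℚ) * (c / (2 * (i : ℚ) + 1)) ^ a with hu
  set v : ℕ → ℕ → ℚ := fun j a =>
    (((β + single i 1 : ℕ →₀ ℕ) j + a).choose a : ℚ) * (c / (2 * (j : ℚ) + 1)) ^ a with hv
  have hu0 : ∀ j, u j 0 = 1 := by simp [hu]
  have hv0 : ∀ j, v j 0 = 1 := by simp [hv]
  have h1 : shiftCoeff c β (α + single i 1) = u i (α i + 1) * (α.erase i).prod u := by
    rw [shiftCoeff, ← Finsupp.mul_prod_erase' (α + single i 1) i u (fun j => hu0 j)]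
    congr 2
    · simp
    · simp [Finsupp.erase_add]
  have h2 : shiftCoeff c (β + single i 1) α = v i (α i) * (α.erase i).prod u := by
    rw [shiftCoeff, ← Finsupp.mul_prod_erase' α i v (fun j => hv0 j)]
    congr 1
    refine Finset.prod_congr rfl fun j hj => ?_
    have hji : j ≠ i := by
      rintro rfl
      simp at hj
    simp [hu, hv, hji]
  rw [h1, h2]
  have h3 : ((α i : ℚ) + 1) * ((β i + (α i + 1)).choose (α i + 1) : ℚ) =
      ((β i : ℚ) + 1) * ((β i + 1 + α i).choose (α i) : ℚ) := by
    have e1 := Nat.choose_succ_right_eq (β i + (α i + 1)) (α i)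
    have e2 : β i + (α i + 1) - α i = β i + 1 := by omega
    rw [e2] at e1
    have e3 : β i + 1 + α i = β i + (α i + 1) := by ring
    rw [e3, mul_comm, mul_comm ((β i : ℚ) + 1)]
    exact_mod_cast e1
  have h4 : (2 * (i : ℚ) + 1) ≠ 0 := by positivity
  simp only [hu, hv, Finsupp.add_apply, Finsupp.single_eq_same, pow_succ]
  field_simp
  linear_combination (c / (2 * (i : ℚ) + 1)) ^ α i * c * (α.erase i).prod u * h3

/-- Euler's identity: the factor k is the weight ∑ (2i+1) αᵢ, and its i-th summand becomes the
derivative in t_{2i+1} through `shiftCoeff_add_single`. -/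
theorem isFlow_miwaShift (c : ℚ) (f : OddSeries A) : IsFlow c (miwaShift c f) := by
  intro N k hk
  ext β
  have hwt : ∀ α ∈ multiIndices k,
      (k : ℚ) = ∑ i ∈ range N, (2 * (i : ℚ) + 1) * (α i : ℚ) := by
    intro α hα
    rw [mem_multiIndices] at hα
    have h : wt α = ∑ i ∈ range N, α i * (2 * i + 1) := by
      unfold wt
      rw [Finsupp.weight_apply, Finsupp.sum]
      simp only [smul_eq_mul]
      refine Finset.sum_subset (fun i hi => ?_) fun i _ hi => ?_
      · have := (le_wt α i (Finsupp.mem_support_iff.mp hi)).1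
        rw [mem_range]
        omega
      · rw [Finsupp.notMem_support_iff.mp hi, zero_mul]
    rw [← hα, h]
    push_cast
    exact sum_congr rfl fun i _ => mul_comm _ _
  rw [coeff_rat_smul, coeff_rat_smul, coeff_miwaShift, flowField, map_sum, map_sum, smul_sum,
    smul_sum]
  have h1 : ∀ α ∈ multiIndices k, (k : ℚ) • shiftCoeff c β α • MvPowerSeries.coeff (β + α) f =
      ∑ i ∈ range N, ((2 * (i : ℚ) + 1) * (α i : ℚ) * shiftCoeff c β α) •
        MvPowerSeries.coeff (β + α) f := by
    intro α hα
    rw [smul_smul, ← sum_smul, ← sum_mul, ← hwt α hα]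
  refine (sum_congr rfl h1).trans ?_
  rw [sum_comm]
  refine sum_congr rfl fun i _ => ?_
  rw [PowerSeries.coeff_X_pow_mul']
  split_ifs with hi
  · rw [coeff_pdSeries, coeff_pd, coeff_miwaShift, smul_sum, smul_sum]
    symm
    -- Adding eᵢ raises the weight by 2i+1. The multi-indices of weight k that are not of this form
    -- have αᵢ = 0 and contribute nothing.
    refine Finset.sum_of_injOn (fun α => α + single i 1) ?_ ?_ ?_ ?_
    · intro a _ b _ h
      simpa using h
    · intro α h
      simp only [mem_coe, mem_multiIndices] at h ⊢
      rw [map_add, wt_single, h]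
      omega
    · intro α h hn
      by_cases h0 : α i = 0
      · simp [h0]
      exfalso
      apply hn
      have hle : single i 1 ≤ α := by
        rw [Finsupp.single_le_iff]; omega
      refine ⟨α - single i 1, ?_, tsub_add_cancel_of_le hle⟩
      simp only [mem_coe, mem_multiIndices] at h ⊢
      rw [← tsub_add_cancel_of_le hle, map_add, wt_single] at h
      omega
    · intro α _
      have h := shiftCoeff_add_single c β α i
      rw [Finsupp.add_apply, Finsupp.single_eq_same, Nat.cast_add, Nat.cast_one, h,
        add_right_comm β, add_assoc β, smul_smul, smul_smul, mul_assoc]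
      rfl
  · rw [map_zero, smul_zero]
    refine sum_eq_zero fun α hα => ?_
    have h0 : α i = 0 := by
      by_contra h0
      have hle : single i 1 ≤ α := by
        rw [Finsupp.single_le_iff]; omega
      rw [mem_multiIndices, ← tsub_add_cancel_of_le hle, map_add, wt_single] at hα
      omega
    simp [h0]

/-- Both sides are flows with the same constant term, so no convolution identity for binomial
coefficients is needed. -/
theorem miwaShift_mul (c : ℚ) (f g : OddSeries A) :
    miwaShift c (f * g) = miwaShift c f * miwaShift c g :=
  (isFlow_miwaShift c _).eq ((isFlow_miwaShift c f).mul (isFlow_miwaShift c g))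
    (by simp only [map_mul, constantCoeff_miwaShift])

theorem miwaShift_pd (c : ℚ) (i : ℕ) (f : OddSeries A) :
    miwaShift c (pd i f) = pdSeries i (miwaShift c f) :=
  (isFlow_miwaShift c _).eq ((isFlow_miwaShift c f).pdSeries i) (by
    rw [constantCoeff_miwaShift, ← PowerSeries.coeff_zero_eq_constantCoeff_apply, coeff_pdSeries,
      PowerSeries.coeff_zero_eq_constantCoeff_apply, constantCoeff_miwaShift])

theorem miwaShift_add (c : ℚ) (f g : OddSeries A) :
    miwaShift c (f + g) = miwaShift c f + miwaShift c g := by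
  ext k β
  simp only [map_add, coeff_miwaShift, smul_add, sum_add_distrib]

theorem miwaShift_smul (c q : ℚ) (f : OddSeries A) :
    miwaShift c (q • f) = q • miwaShift c f := by
  ext k β
  simp only [series_coeff_rat_smul, coeff_rat_smul, coeff_miwaShift, smul_sum]
  exact sum_congr rfl fun p _ => smul_comm _ _ _

theorem miwaShift_neg (c : ℚ) (f : OddSeries A) : miwaShift c (-f) = -miwaShift c f := by
  simpa using miwaShift_smul c (-1) f

theorem miwaShift_zero (c : ℚ) : miwaShift c (0 : OddSeries A) = 0 := by
  simpa using miwaShift_smul c 0 (0 : OddSeries A)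

theorem miwaShift_one (c : ℚ) : miwaShift c (1 : OddSeries A) = 1 := by
  refine (isFlow_miwaShift c _).eq ?_ (by rw [constantCoeff_miwaShift, map_one])
  intro N k _
  have h : flowField N (1 : PowerSeries (OddSeries A)) = 0 := by
    refine sum_eq_zero fun i _ => ?_
    rw [← map_one PowerSeries.C, pdSeries_C, pd_one, map_zero, mul_zero]
  rw [h, map_zero, smul_zero, PowerSeries.coeff_one]
  split_ifs with hk
  · simp [hk]
  · rw [smul_zero]

end MiwaShift

/-! ### The factor (1 + λz)/(1 - λz) -/

section ShiftedDressing

variable {A : Type*} [Ring A] [Algebra ℚ A]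

/-- The coefficients of `(1 + x) / (1 - x) = exp (2 ∑ᵢ x^{2i+1} / (2i+1))`. -/
def cayleyCoeff (a : ℕ) : ℚ := if a = 0 then 1 else 2

/-- The coefficient form of x g' = 2 (x + x³ + x⁵ + …) g for g = (1 + x)/(1 - x), halved. The
induction removes i = 0 and lowers `a` by 2; the bound on `a` makes the truncated sum complete. -/
theorem sum_cayleyCoeff (N a : ℕ) (h : a ≤ 2 * N) :
    ∑ i ∈ range N, (if 2 * i + 1 ≤ a then cayleyCoeff (a - (2 * i + 1)) else 0) = a := by
  induction N generalizing a with
  | zero =>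
    obtain rfl : a = 0 := by omega
    simp
  | succ N ih =>
    rw [sum_range_succ']
    rcases a with _ | _ | a
    · simp
    · simp [cayleyCoeff]
    · have h1 : ∀ i, (2 * (i + 1) + 1 ≤ a + 1 + 1) = (2 * i + 1 ≤ a) := by
        intro i; apply propext; omega
      have h2 : ∀ i, a + 1 + 1 - (2 * (i + 1) + 1) = a - (2 * i + 1) := by
        intro i; omega
      simp only [h1, h2]
      rw [ih a (by omega)]
      simp only [cayleyCoeff]
      norm_num
      ring

theorem mul_cayleyCoeff (a : ℕ) : (a : ℚ) * cayleyCoeff a = 2 * a := by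
  unfold cayleyCoeff
  split_ifs with h
  · simp [h]
  · ring

theorem sum_antidiagonal_ite_le {M : Type*} [AddCommMonoid M] (k r : ℕ) (g : ℕ → ℕ → M) :
    ∑ p ∈ antidiagonal k, (if r ≤ p.1 then g (p.1 - r) p.2 else 0) =
      if r ≤ k then ∑ p ∈ antidiagonal (k - r), g p.1 p.2 else 0 := by
  split_ifs with h
  · symm
    refine Finset.sum_of_injOn (fun p => (p.1 + r, p.2)) ?_ ?_ ?_ ?_
    · rintro ⟨a, b⟩ _ ⟨c, d⟩ _ h
      simpa using h
    · rintro ⟨a, b⟩ h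
      simp only [mem_coe, mem_antidiagonal] at h ⊢
      omega
    · rintro ⟨a, b⟩ h hn
      split_ifs with hr
      · exfalso
        apply hn
        refine ⟨(a - r, b), ?_, ?_⟩
        · simp only [mem_coe, mem_antidiagonal] at h ⊢
          dsimp only at hr
          omega
        · simp only [Prod.mk.injEq, and_true]
          exact Nat.sub_add_cancel hr
      · rfl
    · rintro ⟨a, b⟩ _
      simp
  · refine sum_eq_zero fun p hp => ?_
    have := mem_antidiagonal.mp hp
    rw [if_neg (by omega)]

theorem sum_antidiagonal_ite_le_snd {M : Type*} [AddCommMonoid M] (k r : ℕ) (g : ℕ → ℕ → M) :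
    ∑ p ∈ antidiagonal k, (if r ≤ p.2 then g p.1 (p.2 - r) else 0) =
      if r ≤ k then ∑ p ∈ antidiagonal (k - r), g p.1 p.2 else 0 := by
  rw [← Finset.Nat.sum_antidiagonal_swap]
  refine (sum_antidiagonal_ite_le k r fun a b => g b a).trans ?_
  rw [← Finset.Nat.sum_antidiagonal_swap (n := k - r)]
  rfl

/-- The product of `w(𝐭ₒ + 2[λ],z)` with `(1 + λ z) / (1 - λ z)`. -/
noncomputable def shiftedDressing (w : ℤ → OddSeries A) (n : ℤ) : PowerSeries (OddSeries A) :=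
  PowerSeries.mk fun k => ∑ p ∈ antidiagonal k,
    cayleyCoeff p.1 • PowerSeries.coeff p.2 (miwaShift 2 (w (n - (p.1 : ℤ))))

theorem coeff_shiftedDressing (w : ℤ → OddSeries A) (n : ℤ) (k : ℕ) :
    PowerSeries.coeff k (shiftedDressing w n) = ∑ p ∈ antidiagonal k,
      cayleyCoeff p.1 • PowerSeries.coeff p.2 (miwaShift 2 (w (n - (p.1 : ℤ)))) :=
  PowerSeries.coeff_mk _ _

theorem constantCoeff_shiftedDressing (w : ℤ → OddSeries A) (n : ℤ) :
    PowerSeries.constantCoeff (shiftedDressing w n) = w n := by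
  rw [← PowerSeries.coeff_zero_eq_constantCoeff_apply, coeff_shiftedDressing]
  simp [cayleyCoeff, constantCoeff_miwaShift]

/-- Multiplication by 1 - λz clears the denominator; passing from index n to n - 1 is multiplication
by z. -/
theorem shiftedDressing_sub (w : ℤ → OddSeries A) (n : ℤ) :
    shiftedDressing w n - PowerSeries.X * shiftedDressing w (n - 1) =
      miwaShift 2 (w n) + PowerSeries.X * miwaShift 2 (w (n - 1)) := by
  ext1 k
  rw [map_sub, map_add]
  rcases k with _ | k
  · simp [constantCoeff_shiftedDressing, constantCoeff_miwaShift]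
  rw [PowerSeries.coeff_succ_X_mul, PowerSeries.coeff_succ_X_mul, coeff_shiftedDressing,
    coeff_shiftedDressing, Finset.Nat.sum_antidiagonal_succ, add_sub_assoc, ← sum_sub_distrib]
  congr 1
  · simp [cayleyCoeff]
  -- The sum telescopes: the Cayley coefficients are constant from index 1 on, so only the jump from
  -- index 0 to 1 survives.
  rw [Finset.sum_eq_single (0, k)]
  · simp only [cayleyCoeff, zero_add, one_ne_zero, if_false, if_true, Nat.cast_one, Nat.cast_zero,
      sub_zero]
    module
  · rintro ⟨a, b⟩ h hne
    have ha : a ≠ 0 := by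
      rintro rfl
      apply hne
      rw [mem_antidiagonal] at h
      simp only [zero_add] at h
      rw [h]
    have h1 : n - ((a + 1 : ℕ) : ℤ) = n - 1 - (a : ℤ) := by push_cast; ring
    simp only [cayleyCoeff, h1, ha, if_false, Nat.succ_ne_zero, sub_self]
  · intro h
    simp at h

/-- The flow equation with e^ξ̃ stripped off: the derivative in t_{2i+1} is replaced by itself plus
z^{2i+1}. Splitting k = p.1 + p.2, the part p.2 is accounted for by the flow of the shifted w
(`e1`), the part p.1 by the equation of the Cayley factor (`e2`). -/
theorem smul_coeff_shiftedDressing (w : ℤ → OddSeries A) (n : ℤ) (N k : ℕ) (hk : k ≤ N) :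
    (k : ℚ) • PowerSeries.coeff k (shiftedDressing w n) =
      (2 : ℚ) • ∑ i ∈ range N, if 2 * i + 1 ≤ k then
        pd i (PowerSeries.coeff (k - (2 * i + 1)) (shiftedDressing w n)) +
          PowerSeries.coeff (k - (2 * i + 1)) (shiftedDressing w (n - (2 * i + 1 : ℕ))) else 0 := by
  have h1 : ∀ p ∈ antidiagonal k,
      (k : ℚ) • cayleyCoeff p.1 • PowerSeries.coeff p.2 (miwaShift 2 (w (n - (p.1 : ℤ)))) =
      (2 : ℚ) • ∑ i ∈ range N,
        ((if 2 * i + 1 ≤ p.2 then cayleyCoeff p.1 •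
          pd i (PowerSeries.coeff (p.2 - (2 * i + 1)) (miwaShift 2 (w (n - (p.1 : ℤ))))) else 0) +
        (if 2 * i + 1 ≤ p.1 then cayleyCoeff (p.1 - (2 * i + 1)) •
          PowerSeries.coeff p.2 (miwaShift 2 (w (n - (2 * i + 1 : ℕ) - (p.1 - (2 * i + 1) : ℕ))))
          else 0)) := by
    intro p hp
    have hp' := mem_antidiagonal.mp hp
    rw [sum_add_distrib, smul_add]
    have e1 : (2 : ℚ) • ∑ i ∈ range N, (if 2 * i + 1 ≤ p.2 then cayleyCoeff p.1 •
        pd i (PowerSeries.coeff (p.2 - (2 * i + 1)) (miwaShift 2 (w (n - (p.1 : ℤ))))) else 0) =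
        cayleyCoeff p.1 • (p.2 : ℚ) •
          PowerSeries.coeff p.2 (miwaShift 2 (w (n - (p.1 : ℤ)))) := by
      rw [isFlow_miwaShift 2 _ N p.2 (by omega), smul_comm]
      congr 1
      rw [flowField, map_sum, smul_sum]
      refine sum_congr rfl fun i _ => ?_
      rw [PowerSeries.coeff_X_pow_mul', smul_ite, smul_zero, coeff_pdSeries]
    have e2 : (2 : ℚ) • ∑ i ∈ range N, (if 2 * i + 1 ≤ p.1 then cayleyCoeff (p.1 - (2 * i + 1)) •
          PowerSeries.coeff p.2 (miwaShift 2 (w (n - (2 * i + 1 : ℕ) - (p.1 - (2 * i + 1) : ℕ))))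
          else 0) =
        ((p.1 : ℚ) * cayleyCoeff p.1) •
          PowerSeries.coeff p.2 (miwaShift 2 (w (n - (p.1 : ℤ)))) := by
      rw [mul_cayleyCoeff, mul_smul, ← sum_cayleyCoeff N p.1 (by omega), sum_smul]
      congr 1
      refine sum_congr rfl fun i _ => ?_
      split_ifs with hi
      · have : n - (2 * i + 1 : ℕ) - (p.1 - (2 * i + 1) : ℕ) = n - (p.1 : ℤ) := by omega
        rw [this]
      · rw [zero_smul]
    rw [e1, e2, ← hp']
    push_cast
    module
  rw [coeff_shiftedDressing, smul_sum, sum_congr rfl h1, ← smul_sum, sum_comm]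
  congr 1
  refine sum_congr rfl fun i _ => ?_
  rw [sum_add_distrib, sum_antidiagonal_ite_le_snd k (2 * i + 1) fun a b => cayleyCoeff a •
      pd i (PowerSeries.coeff b (miwaShift 2 (w (n - (a : ℤ))))),
    sum_antidiagonal_ite_le k (2 * i + 1) fun a b => cayleyCoeff a •
      PowerSeries.coeff b (miwaShift 2 (w (n - (2 * i + 1 : ℕ) - (a : ℤ))))]
  split_ifs with hi
  · rw [coeff_shiftedDressing, coeff_shiftedDressing, pd_sum]
    simp only [pd_smul]
  · rw [add_zero]

end ShiftedDressing

/-! ### The exponential factor on series in λ -/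

section ExpSeries

variable {A : Type*} [Ring A] [Algebra ℚ A]

/-- The product with `exp ξ̃(𝐭ₒ,z)`, coefficientwise in `λ`. -/
noncomputable def expSeries (v : ℤ → PowerSeries (OddSeries A)) (n : ℤ) :
    PowerSeries (OddSeries A) :=
  PowerSeries.mk fun k => expMul 1 (fun m => PowerSeries.coeff k (v m)) n

theorem coeff_expSeries (v : ℤ → PowerSeries (OddSeries A)) (n : ℤ) (k : ℕ) :
    PowerSeries.coeff k (expSeries v n) = expMul 1 (fun m => PowerSeries.coeff k (v m)) n :=
  PowerSeries.coeff_mk _ _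

/-- The Miwa shift of a Baker-Akhiezer function. -/
theorem miwaShift_expMul (w : ℤ → OddSeries A) (n : ℤ) :
    miwaShift 2 (expMul 1 w n) = expSeries (shiftedDressing w) n := by
  -- Uniqueness of flows again: `pd_expMul` reduces the flow equation of the right side to that of
  -- the shifted dressing.
  refine (isFlow_miwaShift 2 _).eq ?_ ?_
  · intro N k hk
    rw [coeff_expSeries, ← expMul_smul, flowField, map_sum]
    have h : ∀ i ∈ range N, PowerSeries.coeff k
        (PowerSeries.X ^ (2 * i + 1) * pdSeries i (expSeries (shiftedDressing w) n)) =
        expMul 1 (fun m => if 2 * i + 1 ≤ k then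
          pd i (PowerSeries.coeff (k - (2 * i + 1)) (shiftedDressing w m)) +
          PowerSeries.coeff (k - (2 * i + 1)) (shiftedDressing w (m - (2 * i + 1 : ℕ)))
          else 0) n := by
      intro i _
      rw [PowerSeries.coeff_X_pow_mul']
      split_ifs with hi
      · rw [coeff_pdSeries, coeff_expSeries, pd_expMul]
        simp only [one_smul]
      · exact (congrFun (map_zero (expMulLin (A := A) 1)) n).symm
    rw [sum_congr rfl h, ← expMul_sum, ← expMul_smul]
    congr 1
    funext m
    rw [Pi.smul_apply, Pi.smul_apply, Finset.sum_apply]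
    exact smul_coeff_shiftedDressing w m N k hk
  · rw [constantCoeff_miwaShift, ← PowerSeries.coeff_zero_eq_constantCoeff_apply, coeff_expSeries]
    simp only [PowerSeries.coeff_zero_eq_constantCoeff_apply, constantCoeff_shiftedDressing]

theorem expSeries_add (u v : ℤ → PowerSeries (OddSeries A)) (n : ℤ) :
    expSeries (fun m => u m + v m) n = expSeries u n + expSeries v n := by
  ext1 k
  simp only [coeff_expSeries, map_add]
  exact expMul_add 1 _ _ n

theorem expSeries_sub (u v : ℤ → PowerSeries (OddSeries A)) (n : ℤ) :
    expSeries (fun m => u m - v m) n = expSeries u n - expSeries v n := by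
  rw [eq_sub_iff_add_eq, ← expSeries_add]
  simp only [sub_add_cancel]

theorem expSeries_mul_left (g : PowerSeries (OddSeries A)) (v : ℤ → PowerSeries (OddSeries A))
    (n : ℤ) : expSeries (fun m => g * v m) n = g * expSeries v n := by
  ext1 k
  simp only [coeff_expSeries, PowerSeries.coeff_mul, ← expMul_mul_left, ← expMul_sum]
  congr 1
  funext m
  rw [Finset.sum_apply]

theorem expSeries_divLambda (v : ℤ → PowerSeries (OddSeries A)) (n : ℤ) :
    expSeries (fun m => divLambda (v m)) n = divLambda (expSeries v n) := by
  ext1 k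
  simp only [coeff_expSeries, divLambda, PowerSeries.coeff_mk]

theorem pdt1_expSeries (v : ℤ → PowerSeries (OddSeries A)) (n : ℤ) :
    pdt1 (expSeries v n) = expSeries (fun m => pdt1 (v m) + v (m - 1)) n := by
  ext1 k
  simp only [pdt1_eq_pdSeries, coeff_expSeries, coeff_pdSeries, pd_expMul, map_add, one_smul]
  rfl

theorem expSeries_C (w : ℤ → OddSeries A) (n : ℤ) :
    expSeries (fun m => PowerSeries.C (w m)) n = PowerSeries.C (expMul 1 w n) := by
  ext1 k
  simp only [coeff_expSeries, PowerSeries.coeff_C]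
  split_ifs
  · rfl
  · exact congrFun (map_zero (expMulLin (A := A) 1)) n

end ExpSeries

/-! ### Closure properties of the bilinear identity and its nondegeneracy -/

section Orthogonality

variable {A : Type*} [Ring A]

/-- The bilinear identity `res [f(𝐬ₒ,z) g(𝐭ₒ,z)] = 0`: the symmetric partial sums of every
coefficient are eventually zero. -/
def IsOrthogonal (g f : ℤ → OddSeries A) : Prop :=
  ∀ β γ : ℕ →₀ ℕ, ∀ᶠ N : ℕ in Filter.atTop, ∑ i ∈ Icc (-(N : ℤ)) N,
    MvPowerSeries.coeff β (f i) * MvPowerSeries.coeff γ (g (-1 - i)) = 0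

variable {g : ℤ → OddSeries A}

/-- Asking for eventual vanishing of partial sums makes such closure properties independent of the
supports in z: finitely many eventual statements are intersected. -/
theorem IsOrthogonal.add {f₁ f₂ : ℤ → OddSeries A} (h₁ : IsOrthogonal g f₁)
    (h₂ : IsOrthogonal g f₂) : IsOrthogonal g fun i => f₁ i + f₂ i := by
  intro β γ
  filter_upwards [h₁ β γ, h₂ β γ] with N e₁ e₂
  simp only [map_add, add_mul, sum_add_distrib, e₁, e₂, add_zero]

theorem IsOrthogonal.sub {f₁ f₂ : ℤ → OddSeries A} (h₁ : IsOrthogonal g f₁)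
    (h₂ : IsOrthogonal g f₂) : IsOrthogonal g fun i => f₁ i - f₂ i := by
  intro β γ
  filter_upwards [h₁ β γ, h₂ β γ] with N e₁ e₂
  simp only [map_sub, sub_mul, sum_sub_distrib, e₁, e₂, sub_zero]

theorem isOrthogonal_zero : IsOrthogonal g fun _ => 0 := by
  intro β γ
  simp

theorem IsOrthogonal.sum {ι : Type*} {s : Finset ι} {f : ι → ℤ → OddSeries A}
    (h : ∀ j ∈ s, IsOrthogonal g (f j)) : IsOrthogonal g fun i => ∑ j ∈ s, f j i := by
  intro β γ
  filter_upwards [(Filter.eventually_all_finset s).mpr fun j hj => h j hj β γ] with N hN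
  simp only [map_sum, sum_mul]
  rw [sum_comm]
  exact sum_eq_zero hN

/-- The multiplier depends on 𝐬ₒ only and stands on the outer left, so each new coefficient is a
finite left combination of old ones with the same γ. -/
theorem IsOrthogonal.mul_left {f : ℤ → OddSeries A} (h : IsOrthogonal g f) (a : OddSeries A) :
    IsOrthogonal g fun i => a * f i := by
  intro β γ
  filter_upwards [(Filter.eventually_all_finset (antidiagonal β)).mpr
    fun p _ => h p.2 γ] with N hN
  simp only [MvPowerSeries.coeff_mul, sum_mul, mul_assoc]
  rw [sum_comm]
  refine sum_eq_zero fun p hp => ?_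
  rw [← mul_sum, hN p hp, mul_zero]

/-- `IsOrthogonal`, coefficientwise in `λ`. -/
def IsOrthogonalSeries (g : ℤ → OddSeries A) (f : ℤ → PowerSeries (OddSeries A)) : Prop :=
  ∀ k : ℕ, IsOrthogonal g fun i => PowerSeries.coeff k (f i)

theorem IsOrthogonalSeries.add {f₁ f₂ : ℤ → PowerSeries (OddSeries A)}
    (h₁ : IsOrthogonalSeries g f₁) (h₂ : IsOrthogonalSeries g f₂) :
    IsOrthogonalSeries g fun i => f₁ i + f₂ i := by
  intro k
  simpa only [map_add] using (h₁ k).add (h₂ k)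

theorem IsOrthogonalSeries.sub {f₁ f₂ : ℤ → PowerSeries (OddSeries A)}
    (h₁ : IsOrthogonalSeries g f₁) (h₂ : IsOrthogonalSeries g f₂) :
    IsOrthogonalSeries g fun i => f₁ i - f₂ i := by
  intro k
  simpa only [map_sub] using (h₁ k).sub (h₂ k)

theorem IsOrthogonalSeries.mul_left {f : ℤ → PowerSeries (OddSeries A)}
    (h : IsOrthogonalSeries g f) (a : PowerSeries (OddSeries A)) :
    IsOrthogonalSeries g fun i => a * f i := by
  intro k
  simp only [PowerSeries.coeff_mul]
  exact IsOrthogonal.sum fun p _ => (h p.2).mul_left _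

theorem IsOrthogonalSeries.divLambda {f : ℤ → PowerSeries (OddSeries A)}
    (h : IsOrthogonalSeries g f) : IsOrthogonalSeries g fun i => divLambda (f i) := by
  intro k
  simpa only [OddKP.divLambda, PowerSeries.coeff_mk] using h (k + 1)

theorem IsOrthogonal.C {f : ℤ → OddSeries A} (h : IsOrthogonal g f) :
    IsOrthogonalSeries g fun i => PowerSeries.C (f i) := by
  intro k
  simp only [PowerSeries.coeff_C]
  split_ifs
  · exact h
  · exact isOrthogonal_zero

variable [Algebra ℚ A]

theorem IsOrthogonal.pd {f : ℤ → OddSeries A} (h : IsOrthogonal g f) (j : ℕ) :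
    IsOrthogonal g fun i => pd j (f i) := by
  intro β γ
  filter_upwards [h (β + single j 1) γ] with N hN
  simp only [coeff_pd, smul_mul_assoc]
  rw [← smul_sum, hN, smul_zero]

theorem IsOrthogonal.coeff_miwaShift {f : ℤ → OddSeries A} (h : IsOrthogonal g f) (c : ℚ) (k : ℕ) :
    IsOrthogonal g fun i => PowerSeries.coeff k (miwaShift c (f i)) := by
  intro β γ
  filter_upwards [(Filter.eventually_all_finset (multiIndices k)).mpr
    fun α _ => h (β + α) γ] with N hN
  simp only [OddKP.coeff_miwaShift, sum_mul, smul_mul_assoc]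
  rw [sum_comm]
  refine sum_eq_zero fun α hα => ?_
  rw [← smul_sum, hN α hα, smul_zero]

theorem isOrthogonal_psi {w w' : ℕ → OddSeries A}
    (h : residue (psi w) (psiTilde w') = 0) : IsOrthogonal (psiTilde w') (psi w) := by
  intro β γ
  have h1 := congrFun h (Finsupp.sumFinsuppEquivProdFinsupp.symm (β, γ))
  simp only [residue, Equiv.apply_symm_apply] at h1
  filter_upwards [Filter.eventually_ge_atTop (1 + wt β + wt γ)] with N hN
  rw [← finsum_eq_sum_of_support_subset]
  · exact h1
  · intro i hi
    rw [Function.mem_support] at hi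
    rw [mem_coe, mem_Icc]
    refine ⟨?_, ?_⟩ <;> by_contra hc <;> apply hi
    · rw [psiTilde, coeff_mulExp_of_lt _ _ _ γ (by omega), mul_zero]
    · rw [psi, coeff_mulExp_of_lt _ _ _ β (by omega), zero_mul]

/-- This is the top power of z that accompanies t₁^k, so only the leading term 1 of w̃ contributes.
The value is a nonzero central scalar, which makes the pairing triangular. -/
theorem coeff_single_psiTilde {w' : ℕ → OddSeries A} (hw' : w' 0 = 1) (k : ℕ) :
    MvPowerSeries.coeff (single 0 k) (psiTilde w' k) =
      algebraMap ℚ A ((-1) ^ k / (k.factorial : ℚ)) := by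
  rw [psiTilde, mulExp_eq_expMul, coeff_expMul, Finset.sum_eq_single (0, single 0 k)]
  · simp [wt_single, dressing, hw', expCoeff, Algebra.algebraMap_eq_smul_one]
  · rintro ⟨a, b⟩ h hne
    rw [mem_antidiagonal] at h
    dsimp only at h ⊢
    have h1 : wt a + wt b = k := by rw [← map_add, h, wt_single]; ring
    have h2 : wt a ≠ 0 := by
      intro h0
      apply hne
      obtain rfl := wt_eq_zero h0
      rw [← h, zero_add]
    rw [dressing, if_neg (by omega), map_zero, smul_zero]
  · intro h
    simp [mem_antidiagonal] at h

/-- A function `l(𝐭ₒ,z) e^{ξ̃(𝐭ₒ,z)}` with `l = O(z⁻¹)` that satisfies the bilinear identity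
vanishes. -/
theorem eq_zero_of_isOrthogonal {w' : ℕ → OddSeries A} (hw' : w' 0 = 1) {l : ℤ → OddSeries A}
    (hl : ∀ n, 0 ≤ n → l n = 0) (h : IsOrthogonal (psiTilde w') (expMul 1 l)) (n : ℤ) :
    l n = 0 := by
  suffices H : ∀ k : ℕ, ∀ β : ℕ →₀ ℕ, wt β = k → ∀ n, MvPowerSeries.coeff β (l n) = 0 by
    ext β
    exact H _ β rfl n
  intro k
  induction k using Nat.strong_induction_on with
  | _ k ih =>
    intro β hβ
    -- Every nontrivial term of the exponential meets a coefficient of `l` of smaller weight,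
    -- already known to vanish.
    have h1 : ∀ i, MvPowerSeries.coeff β (expMul 1 l i) = MvPowerSeries.coeff β (l i) := by
      intro i
      rw [coeff_expMul, Finset.sum_eq_single (β, 0)]
      · simp [expCoeff_zero]
      · rintro ⟨a, b⟩ hab hne
        rw [mem_antidiagonal] at hab
        dsimp only at hab ⊢
        have e1 : wt a + wt b = k := by rw [← map_add, hab, hβ]
        have e2 : wt b ≠ 0 := by
          intro h0
          apply hne
          obtain rfl := wt_eq_zero h0
          rw [← hab, add_zero]
        rw [ih (wt a) (by omega) a rfl, smul_zero]
      · intro h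
        simp [mem_antidiagonal] at h
    -- Pairing with the coefficient of t₁^m isolates index -1-m: larger negative indices vanish by
    -- induction on m, nonnegative ones by `hl`, and smaller ones meet powers of z above m, absent
    -- from the coefficient of t₁^m in ψ̃.
    have h2 : ∀ m : ℕ, MvPowerSeries.coeff β (l (-1 - (m : ℤ))) = 0 := by
      intro m
      induction m using Nat.strong_induction_on with
      | _ m ihm =>
        obtain ⟨N, hN, hNm⟩ :=
          ((h β (single 0 m)).and (Filter.eventually_ge_atTop (1 + m))).exists
        rw [Finset.sum_eq_single (-1 - (m : ℤ))] at hN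
        · have e : -1 - (-1 - (m : ℤ)) = (m : ℤ) := by ring
          rw [h1, e, coeff_single_psiTilde hw', ← Algebra.commutes, ← Algebra.smul_def] at hN
          have e2 : ((-1) ^ m / (m.factorial : ℚ) : ℚ) ≠ 0 := by positivity
          have := congrArg (fun x => ((-1) ^ m / (m.factorial : ℚ) : ℚ)⁻¹ • x) hN
          simpa only [smul_smul, inv_mul_cancel₀ e2, one_smul, smul_zero] using this
        · intro i _ hne
          rw [h1]
          rcases le_or_gt 0 i with hi | hi
          · rw [hl i hi, map_zero, zero_mul]
          rcases lt_or_gt_of_ne hne with hlt | hgt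
          · rw [psiTilde, coeff_mulExp_of_lt _ _ _ _ (by rw [wt_single]; push_cast; omega),
              mul_zero]
          · have := ihm (-1 - i).toNat (by omega)
            rw [show -1 - ((-1 - i).toNat : ℤ) = i by omega] at this
            rw [this, zero_mul]
        · intro hn
          exfalso
          apply hn
          rw [mem_Icc]
          omega
    intro n
    rcases le_or_gt 0 n with hn | hn
    · rw [hl n hn, map_zero]
    · have := h2 (-1 - n).toNat
      rwa [show -1 - ((-1 - n).toNat : ℤ) = n by omega] at this

theorem IsOrthogonalSeries.pdt1 {f : ℤ → PowerSeries (OddSeries A)}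
    (h : IsOrthogonalSeries g f) : IsOrthogonalSeries g fun i => pdt1 (f i) := by
  intro k
  simpa only [pdt1_eq_pdSeries, coeff_pdSeries] using (h k).pd 0

theorem IsOrthogonal.miwaShift {f : ℤ → OddSeries A} (h : IsOrthogonal g f) (c : ℚ) :
    IsOrthogonalSeries g fun i => miwaShift c (f i) := fun k => h.coeff_miwaShift c k

/-- The growth condition `l = O(z⁻¹) / (1 - λ z)` is enough for the bilinear identity to imply that
`l` vanishes. -/
theorem eq_zero_of_isOrthogonalSeries {w' : ℕ → OddSeries A} (hw' : w' 0 = 1)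
    {l : ℤ → PowerSeries (OddSeries A)} (hl : ∀ n, 0 ≤ n → l n = PowerSeries.X * l (n - 1))
    (h : IsOrthogonalSeries (psiTilde w') (expSeries l)) (n : ℤ) : l n = 0 := by
  ext1 k
  rw [map_zero]
  induction k generalizing n with
  | zero =>
    refine eq_zero_of_isOrthogonal (l := fun m => PowerSeries.coeff 0 (l m)) hw' ?_ ?_ n
    · intro m hm
      rw [hl m hm, PowerSeries.coeff_zero_X_mul]
    · simpa only [coeff_expSeries] using h 0
  | succ k ih =>
    refine eq_zero_of_isOrthogonal (l := fun m => PowerSeries.coeff (k + 1) (l m)) hw' ?_ ?_ n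
    · intro m hm
      -- At nonnegative indices the coefficient of order k+1 is one of order k, already zero; hence
      -- the growth is again O(z⁻¹).
      rw [hl m hm, PowerSeries.coeff_succ_X_mul, ih]
    · simpa only [coeff_expSeries] using h (k + 1)

end Orthogonality

/-! ### The functional linear equation for the Baker-Akhiezer function -/

section FunctionalLinearEquation

variable {A : Type*} [Ring A] [Algebra ℚ A]

theorem isUnit_F (φ : OddSeries A) : IsUnit (F φ) := by
  rw [PowerSeries.isUnit_iff_constantCoeff]
  have h : PowerSeries.constantCoeff (F φ) = 1 := by
    rw [F, ← PowerSeries.coeff_zero_eq_constantCoeff_apply, map_sub, series_coeff_rat_smul,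
      PowerSeries.coeff_zero_X_mul, smul_zero, PowerSeries.coeff_zero_eq_constantCoeff_apply,
      map_one, sub_zero]
  rw [h]
  exact isUnit_one

/-- The factor `θ̃_{2[λ]} - θ̃ + (φ_{2[λ]} - φ)_{t₁} / 2 - [φ, φ_{2[λ]}] / 2`. -/
noncomputable def shiftPotential (φ θt : OddSeries A) : PowerSeries (OddSeries A) :=
  (miwaShift 2 θt - PowerSeries.C θt)
    + (1 / 2 : ℚ) • pdt1 (miwaShift 2 φ - PowerSeries.C φ)
    - (1 / 2 : ℚ) • ⁅PowerSeries.C φ, miwaShift 2 φ⁆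

theorem functionalLinearEquation_iff (φ θt ψ : OddSeries A) :
    FunctionalLinearEquation φ θt ψ ↔
      divLambda (F φ * (miwaShift 2 ψ - PowerSeries.C ψ)) - pdt1 (miwaShift 2 ψ + PowerSeries.C ψ) =
        (1 / 2 : ℚ) • (PowerSeries.X * shiftPotential φ θt * Ring.inverse (F φ)
          * (miwaShift 2 ψ + PowerSeries.C ψ)) := Iff.rfl

theorem dressing_of_pos {B : Type*} [Ring B] (w : ℕ → OddSeries B) {n : ℤ} (h : 0 < n) :
    dressing w n = 0 :=
  if_neg (by omega)

theorem miwaShift_thetaTilde (w : ℕ → OddSeries A) :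
    miwaShift 2 (thetaTilde w) = -miwaShift 2 (w 2) +
      (1 / 2 : ℚ) • (pdSeries 0 (miwaShift 2 (phi w)) +
        miwaShift 2 (phi w) * miwaShift 2 (phi w)) := by
  rw [thetaTilde, miwaShift_add, miwaShift_neg, miwaShift_smul, miwaShift_add, miwaShift_pd, sq,
    miwaShift_mul]

theorem C_rat_smul (q : ℚ) (f : OddSeries A) :
    PowerSeries.C (q • f) = q • PowerSeries.C f := by
  ext1 k
  rw [series_coeff_rat_smul, PowerSeries.coeff_C, PowerSeries.coeff_C]
  split_ifs
  · rfl
  · rw [smul_zero]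

theorem C_thetaTilde (w : ℕ → OddSeries A) :
    PowerSeries.C (thetaTilde w) = -PowerSeries.C (w 2) +
      (1 / 2 : ℚ) • (pdSeries 0 (PowerSeries.C (phi w)) +
        PowerSeries.C (phi w) * PowerSeries.C (phi w)) := by
  rw [thetaTilde, map_add, map_neg, C_rat_smul, map_add, pdSeries_C, sq, map_mul]

/-- The coefficient of `z⁰`. -/
theorem coeff_zero_cancellation (w : ℕ → OddSeries A) :
    F (phi w) * (PowerSeries.X * (miwaShift 2 (w 1) + PowerSeries.C (w 1)))
      - PowerSeries.X * (PowerSeries.X * pdSeries 0 (miwaShift 2 (w 1) - PowerSeries.C (w 1))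
        + (miwaShift 2 (w 1) + PowerSeries.X * miwaShift 2 (w 2) + PowerSeries.C (w 1)
          - PowerSeries.X * PowerSeries.C (w 2)))
      - PowerSeries.X * (PowerSeries.X * shiftPotential (phi w) (thetaTilde w)) = 0 := by
  have h1 : w 1 = -phi w := by rw [phi, neg_neg]
  rw [shiftPotential, miwaShift_thetaTilde, C_thetaTilde, pdt1_eq_pdSeries, h1, miwaShift_neg,
    map_neg, F, Ring.lie_def]
  simp only [pdSeries_sub]
  rw [← neg_one_smul ℚ (miwaShift 2 (phi w)), ← neg_one_smul ℚ (PowerSeries.C (phi w))]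
  generalize miwaShift 2 (w 2) = u₂
  generalize PowerSeries.C (w 2) = w₂
  have e1 : pdSeries 0 ((-1 : ℚ) • miwaShift 2 (phi w)) =
      (-1 : ℚ) • pdSeries 0 (miwaShift 2 (phi w)) := by
    rw [← miwaShift_smul, ← miwaShift_pd, pd_smul, miwaShift_smul, miwaShift_pd]
  have e2 : pdSeries 0 ((-1 : ℚ) • PowerSeries.C (phi w)) =
      (-1 : ℚ) • pdSeries 0 (PowerSeries.C (phi w)) := by
    rw [← C_rat_smul, pdSeries_C, pdSeries_C, pd_smul, C_rat_smul]
  rw [e1, e2]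
  generalize pdSeries 0 (miwaShift 2 (phi w)) = dΦ
  generalize pdSeries 0 (PowerSeries.C (phi w)) = dφ
  generalize miwaShift 2 (phi w) = Φ
  generalize PowerSeries.C (phi w) = φ
  -- What remains is a noncommutative polynomial identity in which λ is central. The commutator in
  -- the potential arises from (Φ - φ)(Φ + φ) = Φ² - φ² - [φ, Φ].
  have c1 : ∀ f, Φ * (PowerSeries.X * f) = PowerSeries.X * (Φ * f) := fun f => by
    rw [← mul_assoc, ← mul_assoc, (PowerSeries.commute_X Φ).eq]
  have c2 : ∀ f, φ * (PowerSeries.X * f) = PowerSeries.X * (φ * f) := fun f => by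
    rw [← mul_assoc, ← mul_assoc, (PowerSeries.commute_X φ).eq]
  simp only [mul_add, mul_sub, sub_mul, smul_mul_assoc, mul_smul_comm, smul_add,
    smul_sub, smul_smul, mul_assoc, one_mul, mul_neg, c1, c2]
  module

/-- Here `s` and `d` are w_{2[λ]}(1 + λz) ± w(1 - λz), that is, 1 - λz times the sum and the
difference of the shifted and unshifted dressings. The coefficient of z⁰ in `s` is 2F and that of z¹
is zero. For n = 1 the terms F · 2λ and λ · 2F cancel; for n = 0 the factor F⁻¹ in the potential
cancels against 2F, leaving `coeff_zero_cancellation`; for n > 1 every term is zero. -/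
theorem dressing_cancellation (w : ℕ → OddSeries A) (hw : w 0 = 1) {n : ℤ} (hn : 0 ≤ n)
    (u v s d : ℤ → PowerSeries (OddSeries A)) (hu : ∀ m, u m = miwaShift 2 (dressing w m))
    (hv : ∀ m, v m = PowerSeries.C (dressing w m))
    (hs : ∀ m, s m = u m + PowerSeries.X * u (m - 1) + v m - PowerSeries.X * v (m - 1))
    (hd : ∀ m, d m = u m + PowerSeries.X * u (m - 1) - v m + PowerSeries.X * v (m - 1)) :
    F (phi w) * d n - PowerSeries.X * (pdSeries 0 (s n) + s (n - 1))
      - PowerSeries.X * ((1 / 2 : ℚ) • (PowerSeries.X * shiftPotential (phi w) (thetaTilde w)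
        * Ring.inverse (F (phi w))) * s n) = 0 := by
  have u_pos : ∀ m, 0 < m → u m = 0 := fun m hm => by
    rw [hu, dressing_of_pos w hm, miwaShift_zero]
  have v_pos : ∀ m, 0 < m → v m = 0 := fun m hm => by
    rw [hv, dressing_of_pos w hm, map_zero]
  have u_zero : u 0 = 1 := by
    rw [hu, show dressing w 0 = 1 from hw, miwaShift_one]
  have v_zero : v 0 = 1 := by
    rw [hv, show dressing w 0 = 1 from hw, map_one]
  have hw1 : w 1 = -phi w := by rw [phi, neg_neg]
  have hs0 : s 0 = (2 : ℚ) • F (phi w) := by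
    rw [hs, u_zero, v_zero, hu, hv, show dressing w (0 - 1) = w 1 from rfl, hw1, miwaShift_neg,
      map_neg, F]
    simp only [mul_neg, mul_sub]
    module
  have hX : pdSeries 0 (PowerSeries.X : PowerSeries (OddSeries A)) = 0 := by
    have := pdSeries_X_mul (A := A) 0 (PowerSeries.C 1)
    rwa [pdSeries_C, pd_one, map_zero, mul_zero, map_one, mul_one] at this
  obtain rfl | rfl | h2 : n = 0 ∨ n = 1 ∨ 1 < n := by omega
  · have hpd : pdSeries 0 (s 0) = PowerSeries.X *
        pdSeries 0 (miwaShift 2 (w 1) - PowerSeries.C (w 1)) := by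
      have : s 0 = PowerSeries.C (1 + 1) + PowerSeries.X *
          (miwaShift 2 (w 1) - PowerSeries.C (w 1)) := by
        rw [hs, u_zero, v_zero, hu, hv, show dressing w (0 - 1) = w 1 from rfl, map_add, map_one,
          mul_sub]
        abel
      rw [this, pdSeries_add, pdSeries_C, pd_add, pd_one, add_zero, map_zero, zero_add,
        pdSeries_X_mul]
    have hd0 : d 0 = PowerSeries.X * (miwaShift 2 (w 1) + PowerSeries.C (w 1)) := by
      rw [hd, u_zero, v_zero, hu, hv, show dressing w (0 - 1) = w 1 from rfl, mul_add]
      abel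
    have hs1 : s (0 - 1) = miwaShift 2 (w 1) + PowerSeries.X * miwaShift 2 (w 2)
        + PowerSeries.C (w 1) - PowerSeries.X * PowerSeries.C (w 2) := by
      rw [hs, hu, hv, hu, hv]
      rfl
    have hG : (1 / 2 : ℚ) • (PowerSeries.X * shiftPotential (phi w) (thetaTilde w)
        * Ring.inverse (F (phi w))) * s 0 =
        PowerSeries.X * shiftPotential (phi w) (thetaTilde w) := by
      rw [hs0, mul_smul_comm, smul_mul_assoc, smul_smul, mul_assoc,
        Ring.inverse_mul_cancel _ (isUnit_F _)]
      norm_num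
    rw [hpd, hd0, hs1, hG]
    exact coeff_zero_cancellation w
  · have hs1 : s 1 = 0 := by
      rw [hs, u_pos 1 one_pos, v_pos 1 one_pos, sub_self, u_zero, v_zero]
      abel
    have hd1 : d 1 = (2 : ℚ) • PowerSeries.X := by
      rw [hd, u_pos 1 one_pos, v_pos 1 one_pos, sub_self, u_zero, v_zero, mul_one]
      module
    rw [hs1, hd1, sub_self, hs0, pdSeries_zero, mul_zero, mul_zero, zero_add, sub_zero,
      mul_smul_comm, mul_smul_comm, (PowerSeries.commute_X _).eq, sub_self]
  · have e1 : pdSeries 0 (s n) = 0 ∧ s n = 0 ∧ d n = 0 := by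
      have : s n = 0 := by
        rw [hs, u_pos n (by omega), v_pos n (by omega), u_pos _ (by omega), v_pos _ (by omega)]
        simp
      refine ⟨by rw [this, pdSeries_zero], this, ?_⟩
      rw [hd, u_pos n (by omega), v_pos n (by omega), u_pos _ (by omega), v_pos _ (by omega)]
      simp
    have e2 : s (n - 1) = 0 := by
      rw [hs, u_pos (n - 1) (by omega), v_pos (n - 1) (by omega)]
      obtain rfl | h3 : n = 2 ∨ 2 < n := by omega
      · rw [show (2 : ℤ) - 1 - 1 = 0 by norm_num, u_zero, v_zero]
        abel
      · rw [u_pos _ (by omega), v_pos _ (by omega)]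
        simp
    rw [e1.1, e1.2.1, e1.2.2, e2]
    simp

/-- The Baker-Akhiezer function of the odd KP hierarchy solves the functional linear equation. -/
theorem functionalLinearEquation_psi {w w' : ℕ → OddSeries A} (hw : w 0 = 1) (hw' : w' 0 = 1)
    (bilinear : residue (psi w) (psiTilde w') = 0) (n : ℤ) :
    FunctionalLinearEquation (phi w) (thetaTilde w) (psi w n) := by
  set v := shiftedDressing (dressing w) with hv
  set c : ℤ → PowerSeries (OddSeries A) := fun m => PowerSeries.C (dressing w m) with hc
  set K := (1 / 2 : ℚ) • (PowerSeries.X * shiftPotential (phi w) (thetaTilde w)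
    * Ring.inverse (F (phi w))) with hK
  -- The difference of the two sides of (*) with e^ξ̃ removed; the derivative in t₁ becomes the
  -- derivative plus z, hence the index m - 1.
  set l : ℤ → PowerSeries (OddSeries A) := fun m =>
    divLambda (F (phi w) * (v m - c m)) - (pdt1 (v m + c m) + (v (m - 1) + c (m - 1)))
      - K * (v m + c m) with hl
  have hexp : ∀ m, expSeries l m =
      divLambda (F (phi w) * (miwaShift 2 (psi w m) - PowerSeries.C (psi w m)))
        - pdt1 (miwaShift 2 (psi w m) + PowerSeries.C (psi w m))
        - K * (miwaShift 2 (psi w m) + PowerSeries.C (psi w m)) := by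
    intro m
    have h1 : miwaShift 2 (psi w m) = expSeries v m := miwaShift_expMul (dressing w) m
    have h2 : PowerSeries.C (psi w m) = expSeries c m := (expSeries_C (dressing w) m).symm
    rw [h1, h2, ← expSeries_sub, ← expSeries_add, ← expSeries_mul_left, ← expSeries_mul_left,
      ← expSeries_divLambda, pdt1_expSeries, ← expSeries_sub, ← expSeries_sub]
  have horth : IsOrthogonalSeries (psiTilde w') (expSeries l) := by
    have h0 := isOrthogonal_psi bilinear
    have h1 := h0.miwaShift 2
    rw [funext hexp]
    exact (((h1.sub h0.C).mul_left _).divLambda.sub (h1.add h0.C).pdt1).sub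
      ((h1.add h0.C).mul_left K)
  have hrec : ∀ m, 0 ≤ m → l m = PowerSeries.X * l (m - 1) := by
    intro m hm
    have hdiv : ∀ m, PowerSeries.X * divLambda (F (phi w) * (v m - c m)) =
        F (phi w) * (v m - c m) := by
      intro m
      apply lambda_mul_divLambda
      rw [map_mul, map_sub, hv, constantCoeff_shiftedDressing, PowerSeries.constantCoeff_C,
        sub_self, mul_zero]
    have hsub : ∀ m, v m = PowerSeries.X * v (m - 1) + miwaShift 2 (dressing w m)
        + PowerSeries.X * miwaShift 2 (dressing w (m - 1)) := by
      intro m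
      rw [add_assoc, ← shiftedDressing_sub]
      abel
    obtain ⟨s, hs⟩ : ∃ s : ℤ → PowerSeries (OddSeries A), ∀ m, s m =
        miwaShift 2 (dressing w m) + PowerSeries.X * miwaShift 2 (dressing w (m - 1)) + c m
          - PowerSeries.X * c (m - 1) := ⟨_, fun _ => rfl⟩
    obtain ⟨d, hd⟩ : ∃ d : ℤ → PowerSeries (OddSeries A), ∀ m, d m =
        miwaShift 2 (dressing w m) + PowerSeries.X * miwaShift 2 (dressing w (m - 1)) - c m
          + PowerSeries.X * c (m - 1) := ⟨_, fun _ => rfl⟩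
    have key := dressing_cancellation w hw hm (fun m => miwaShift 2 (dressing w m)) c s d
      (fun _ => rfl) (fun _ => rfl) hs hd
    rw [← hK] at key
    have hy : ∀ m, v m + c m = PowerSeries.X * (v (m - 1) + c (m - 1)) + s m := by
      intro m
      rw [hsub m, hs, mul_add]
      abel
    have hq : v m - c m = PowerSeries.X * (v (m - 1) - c (m - 1)) + d m := by
      rw [hsub m, hd, mul_sub]
      abel
    have e1 : PowerSeries.X * l m = F (phi w) * (v m - c m)
        - PowerSeries.X * (pdSeries 0 (v m + c m) + (v (m - 1) + c (m - 1)))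
        - PowerSeries.X * (K * (v m + c m)) := by
      rw [← hdiv, ← mul_sub, ← mul_sub]
      rfl
    have e2 : PowerSeries.X * l (m - 1) = F (phi w) * (v (m - 1) - c (m - 1))
        - PowerSeries.X * (pdSeries 0 (v (m - 1) + c (m - 1)) + (v (m - 1 - 1) + c (m - 1 - 1)))
        - PowerSeries.X * (K * (v (m - 1) + c (m - 1))) := by
      rw [← hdiv, ← mul_sub, ← mul_sub]
      rfl
    -- After multiplication by λ the quotient `divLambda` disappears, and the difference of the two
    -- sides is the expression in `key`.
    apply PowerSeries.X_mul_cancel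
    rw [e2, e1, hq, hy m, hy (m - 1), pdSeries_add, pdSeries_X_mul, ← hy (m - 1),
      hy (m - 1)]
    have c1 : ∀ f, F (phi w) * (PowerSeries.X * f) = PowerSeries.X * (F (phi w) * f) := fun f => by
      rw [← mul_assoc, ← mul_assoc, (PowerSeries.commute_X _).eq]
    have c2 : ∀ f, K * (PowerSeries.X * f) = PowerSeries.X * (K * f) := fun f => by
      rw [← mul_assoc, ← mul_assoc, (PowerSeries.commute_X _).eq]
    rw [← sub_eq_zero, ← key]
    simp only [mul_add, mul_sub, c1, c2]
    abel
  have h := hexp n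
  have h0 : expSeries (fun _ => (0 : PowerSeries (OddSeries A))) n = 0 := by
    simpa using expSeries_sub (fun _ => (0 : PowerSeries (OddSeries A))) (fun _ => 0) n
  rw [funext (eq_zero_of_isOrthogonalSeries hw' hrec horth), h0, eq_comm, sub_eq_zero, hK,
    smul_mul_assoc] at h
  exact h

end FunctionalLinearEquation

/-! ### Expansion in λ and the linear system -/

section LinearSystem

variable {A : Type*} [Ring A] [Algebra ℚ A]

theorem coeff_zero_miwaShift (f : OddSeries A) :
    PowerSeries.coeff 0 (miwaShift 2 f) = f := by
  rw [PowerSeries.coeff_zero_eq_constantCoeff_apply, constantCoeff_miwaShift]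

theorem eq_inv_smul {M : Type*} [AddCommGroup M] [Module ℚ M] {q : ℚ} (hq : q ≠ 0) {x y : M}
    (h : q • x = y) : x = q⁻¹ • y := by
  rw [← h, smul_smul, inv_mul_cancel₀ hq, one_smul]

/-- The flow equation at order k expresses k times the k-th coefficient through derivatives of
earlier ones; this formula and the next four follow recursively. -/
theorem coeff_one_miwaShift (f : OddSeries A) :
    PowerSeries.coeff 1 (miwaShift 2 f) = (2 : ℚ) • pd 0 f := by
  have h := isFlow_miwaShift 2 f 1 1 le_rfl
  simpa [flowField, sum_range_succ, PowerSeries.coeff_X_pow_mul', coeff_pdSeries,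
    constantCoeff_miwaShift] using h

theorem coeff_two_miwaShift (f : OddSeries A) :
    PowerSeries.coeff 2 (miwaShift 2 f) = (2 : ℚ) • pd 0 (pd 0 f) := by
  have h := isFlow_miwaShift 2 f 2 2 le_rfl
  simp only [flowField, sum_range_succ, range_zero, sum_empty, PowerSeries.coeff_X_pow_mul',
    coeff_pdSeries, map_add, map_zero] at h
  norm_num [coeff_one_miwaShift, pd_smul] at h
  exact h

theorem coeff_three_miwaShift (f : OddSeries A) :
    PowerSeries.coeff 3 (miwaShift 2 f) =
      (4 / 3 : ℚ) • pd 0 (pd 0 (pd 0 f)) + (2 / 3 : ℚ) • pd 1 f := by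
  have h := isFlow_miwaShift 2 f 3 3 le_rfl
  simp only [flowField, sum_range_succ, range_zero, sum_empty, PowerSeries.coeff_X_pow_mul',
    coeff_pdSeries, map_add, map_zero] at h
  norm_num [coeff_two_miwaShift, constantCoeff_miwaShift, pd_smul] at h
  rw [eq_inv_smul three_ne_zero h]
  module

theorem coeff_four_miwaShift (f : OddSeries A) :
    PowerSeries.coeff 4 (miwaShift 2 f) =
      (2 / 3 : ℚ) • pd 0 (pd 0 (pd 0 (pd 0 f))) + (4 / 3 : ℚ) • pd 0 (pd 1 f) := by
  have h := isFlow_miwaShift 2 f 4 4 le_rfl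
  simp only [flowField, sum_range_succ, range_zero, sum_empty, PowerSeries.coeff_X_pow_mul',
    coeff_pdSeries, map_add, map_zero] at h
  norm_num [coeff_three_miwaShift, coeff_one_miwaShift, pd_smul, pd_add, pd_comm 1 0] at h
  rw [eq_inv_smul four_ne_zero h]
  module

theorem coeff_five_miwaShift (f : OddSeries A) :
    PowerSeries.coeff 5 (miwaShift 2 f) =
      (4 / 15 : ℚ) • pd 0 (pd 0 (pd 0 (pd 0 (pd 0 f)))) + (4 / 3 : ℚ) • pd 0 (pd 0 (pd 1 f))
        + (2 / 5 : ℚ) • pd 2 f := by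
  have h := isFlow_miwaShift 2 f 5 5 le_rfl
  simp only [flowField, sum_range_succ, range_zero, sum_empty, PowerSeries.coeff_X_pow_mul',
    coeff_pdSeries, map_add, map_zero] at h
  norm_num [coeff_four_miwaShift, coeff_two_miwaShift, constantCoeff_miwaShift, pd_smul, pd_add,
    pd_comm 1 0] at h
  rw [eq_inv_smul (by norm_num : (5 : ℚ) ≠ 0) h]
  module

theorem coeff_zero_F_mul (φ : OddSeries A) (g : PowerSeries (OddSeries A)) :
    PowerSeries.coeff 0 (F φ * g) = PowerSeries.coeff 0 g := by
  rw [F, sub_mul, one_mul, map_sub, smul_mul_assoc, series_coeff_rat_smul, mul_assoc,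
    PowerSeries.coeff_zero_X_mul, smul_zero, sub_zero]

theorem coeff_succ_F_mul (φ : OddSeries A) (g : PowerSeries (OddSeries A)) (k : ℕ) :
    PowerSeries.coeff (k + 1) (F φ * g) = PowerSeries.coeff (k + 1) g - (1 / 2 : ℚ) •
      ∑ p ∈ antidiagonal k, PowerSeries.coeff p.1 (miwaShift 2 φ - PowerSeries.C φ) *
        PowerSeries.coeff p.2 g := by
  rw [F, sub_mul, one_mul, map_sub, smul_mul_assoc, series_coeff_rat_smul, mul_assoc,
    PowerSeries.coeff_succ_X_mul, PowerSeries.coeff_mul]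

theorem coeff_zero_miwaShift_sub (f : OddSeries A) :
    PowerSeries.coeff 0 (miwaShift 2 f - PowerSeries.C f) = 0 := by
  rw [map_sub, coeff_zero_miwaShift, PowerSeries.coeff_zero_C, sub_self]

theorem coeff_succ_miwaShift_sub (f : OddSeries A) (k : ℕ) :
    PowerSeries.coeff (k + 1) (miwaShift 2 f - PowerSeries.C f) =
      PowerSeries.coeff (k + 1) (miwaShift 2 f) := by
  rw [map_sub, PowerSeries.coeff_succ_C, sub_zero]

theorem coeff_zero_miwaShift_add (f : OddSeries A) :
    PowerSeries.coeff 0 (miwaShift 2 f + PowerSeries.C f) = (2 : ℚ) • f := by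
  rw [map_add, coeff_zero_miwaShift, PowerSeries.coeff_zero_C, two_smul]

theorem coeff_succ_miwaShift_add (f : OddSeries A) (k : ℕ) :
    PowerSeries.coeff (k + 1) (miwaShift 2 f + PowerSeries.C f) =
      PowerSeries.coeff (k + 1) (miwaShift 2 f) := by
  rw [map_add, PowerSeries.coeff_succ_C, add_zero]

theorem coeff_zero_shiftPotential (φ θt : OddSeries A) :
    PowerSeries.coeff 0 (shiftPotential φ θt) = 0 := by
  rw [shiftPotential, map_sub, map_add, coeff_zero_miwaShift_sub, series_coeff_rat_smul,
    series_coeff_rat_smul, pdt1_eq_pdSeries, coeff_pdSeries, coeff_zero_miwaShift_sub, pd_zero,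
    Ring.lie_def, map_sub, PowerSeries.coeff_C_mul, PowerSeries.coeff_mul_C, coeff_zero_miwaShift]
  simp

theorem coeff_succ_shiftPotential (φ θt : OddSeries A) (k : ℕ) :
    PowerSeries.coeff (k + 1) (shiftPotential φ θt) =
      PowerSeries.coeff (k + 1) (miwaShift 2 θt)
        + (1 / 2 : ℚ) • pd 0 (PowerSeries.coeff (k + 1) (miwaShift 2 φ))
        - (1 / 2 : ℚ) • (φ * PowerSeries.coeff (k + 1) (miwaShift 2 φ)
          - PowerSeries.coeff (k + 1) (miwaShift 2 φ) * φ) := by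
  rw [shiftPotential, map_sub, map_add, coeff_succ_miwaShift_sub, series_coeff_rat_smul,
    series_coeff_rat_smul, pdt1_eq_pdSeries, coeff_pdSeries, coeff_succ_miwaShift_sub,
    Ring.lie_def, map_sub, PowerSeries.coeff_C_mul, PowerSeries.coeff_mul_C]

/-- The coefficient of `λ^{k+1}` of the functional linear equation, in terms of
`χ = F(λ)⁻¹ (ψ_{2[λ]} + ψ)`. -/
theorem coeff_functionalLinearEquation {φ θt ψ : OddSeries A}
    (h : FunctionalLinearEquation φ θt ψ) (k : ℕ) :
    PowerSeries.coeff (k + 2) (F φ * (miwaShift 2 ψ - PowerSeries.C ψ))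
        - pd 0 (PowerSeries.coeff (k + 1) (miwaShift 2 ψ)) =
      (1 / 2 : ℚ) • ∑ p ∈ antidiagonal k, PowerSeries.coeff p.1 (shiftPotential φ θt) *
        PowerSeries.coeff p.2 (Ring.inverse (F φ) * (miwaShift 2 ψ + PowerSeries.C ψ)) := by
  -- The factor λ⁻¹ on the left raises the index to k + 2, the factor λ on the right lowers it to k.
  have h1 := congrArg (PowerSeries.coeff (k + 1)) ((functionalLinearEquation_iff φ θt ψ).mp h)
  rw [map_sub, divLambda, PowerSeries.coeff_mk, pdt1_eq_pdSeries, coeff_pdSeries,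
    coeff_succ_miwaShift_add, series_coeff_rat_smul, mul_assoc, mul_assoc,
    PowerSeries.coeff_succ_X_mul] at h1
  rw [← PowerSeries.coeff_mul]
  exact h1

section InverseF

variable (φ ψ : OddSeries A)

theorem F_mul_inverse_mul (g : PowerSeries (OddSeries A)) :
    F φ * (Ring.inverse (F φ) * g) = g := by
  rw [← mul_assoc, Ring.mul_inverse_cancel _ (isUnit_F φ), one_mul]

/-- The coefficients of χ = F⁻¹(ψ_{2[λ]} + ψ) are solved from Fχ = ψ_{2[λ]} + ψ without expanding
F⁻¹. Orders up to 2 suffice below, because the potential has no constant term. -/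
theorem coeff_zero_inverse_F_mul :
    PowerSeries.coeff 0 (Ring.inverse (F φ) * (miwaShift 2 ψ + PowerSeries.C ψ)) =
      (2 : ℚ) • ψ := by
  rw [← coeff_zero_F_mul φ, F_mul_inverse_mul, coeff_zero_miwaShift_add]

theorem coeff_one_inverse_F_mul :
    PowerSeries.coeff 1 (Ring.inverse (F φ) * (miwaShift 2 ψ + PowerSeries.C ψ)) =
      (2 : ℚ) • pd 0 ψ := by
  have h := coeff_succ_F_mul φ (Ring.inverse (F φ) * (miwaShift 2 ψ + PowerSeries.C ψ)) 0
  rw [F_mul_inverse_mul, coeff_succ_miwaShift_add, coeff_one_miwaShift] at h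
  simpa [coeff_zero_miwaShift_sub, constantCoeff_miwaShift] using h.symm

theorem coeff_two_inverse_F_mul :
    PowerSeries.coeff 2 (Ring.inverse (F φ) * (miwaShift 2 ψ + PowerSeries.C ψ)) =
      (2 : ℚ) • pd 0 (pd 0 ψ) + (2 : ℚ) • (pd 0 φ * ψ) := by
  have h := coeff_succ_F_mul φ (Ring.inverse (F φ) * (miwaShift 2 ψ + PowerSeries.C ψ)) 1
  rw [F_mul_inverse_mul, coeff_succ_miwaShift_add, coeff_two_miwaShift] at h
  simp only [Finset.Nat.sum_antidiagonal_succ, Finset.Nat.antidiagonal_zero, sum_singleton,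
    zero_add, Nat.reduceAdd, coeff_zero_miwaShift_sub, coeff_succ_miwaShift_sub,
    coeff_one_miwaShift, coeff_zero_inverse_F_mul, zero_mul, smul_mul_assoc, mul_smul_comm] at h
  rw [h]
  module

end InverseF

theorem linearSystemTilde_of_functionalLinearEquation {φ θt ψ : OddSeries A}
    (h : FunctionalLinearEquation φ θt ψ) : LinearSystemTilde φ θt ψ := by
  -- These are the orders λ² and λ⁴ of (*), where the derivatives of ψ in t₃ and t₅ enter with
  -- coefficients 2/3 and 2/5; hence the multipliers 3/2 and 5/2 below.
  have h1 := coeff_functionalLinearEquation h 1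
  have h3 := coeff_functionalLinearEquation h 3
  simp only [coeff_succ_F_mul, Finset.Nat.sum_antidiagonal_succ, Finset.Nat.antidiagonal_zero,
    sum_singleton, zero_add, Nat.reduceAdd, coeff_zero_miwaShift_sub, coeff_succ_miwaShift_sub,
    coeff_one_miwaShift, coeff_two_miwaShift, coeff_three_miwaShift, coeff_four_miwaShift,
    coeff_five_miwaShift, coeff_zero_shiftPotential, coeff_succ_shiftPotential,
    coeff_zero_inverse_F_mul, coeff_one_inverse_F_mul, coeff_two_inverse_F_mul,
    zero_mul, mul_zero, pd_smul, pd_add] at h1 h3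
  have hψ : pd 1 ψ = pd 0 (pd 0 (pd 0 ψ)) + (3 : ℚ) • (pd 0 φ * pd 0 ψ)
      + (3 / 2 : ℚ) • (((2 : ℚ) • pd 0 θt + pd 0 (pd 0 φ) + ⁅pd 0 φ, φ⁆) * ψ) := by
    rw [Ring.lie_def]
    simp only [add_mul, sub_mul, smul_mul_assoc, mul_smul_comm, smul_add,
      smul_sub, smul_smul, mul_assoc] at h1 ⊢
    linear_combination (norm := module) (3 / 2 : ℚ) • h1
  refine ⟨hψ, ?_⟩
  -- At order λ⁴ the t₃-derivative of ψ also occurs; the equation just found eliminates it.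
  rw [hψ] at h3
  simp only [Ring.lie_def, pd_mul, sq, mul_add, mul_sub, add_mul, sub_mul, smul_mul_assoc,
    mul_smul_comm, smul_add, smul_sub, smul_smul, mul_assoc] at h3 ⊢
  linear_combination (norm := module) (5 / 2 : ℚ) • h3

/-- Substitution for the t₁- and t₃-derivatives of θ̃ cancels every commutator with an
undifferentiated φ; `J` enters only through the t₃-derivative. -/
theorem LinearSystemTilde.linearSystem {φ θt θ J ψ : OddSeries A}
    (h : LinearSystemTilde φ θt ψ) (hθ : ThetaRelation φ θt θ J) : LinearSystem φ θ J ψ := by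
  obtain ⟨h3, h5⟩ := h
  obtain ⟨e1, e3⟩ := hθ
  have e3' : pd 1 θt = pd 1 θ + (1 / 2 : ℚ) • ⁅φ, pd 1 φ⁆ + J := by
    rw [e3]
    abel
  refine ⟨?_, ?_⟩
  · rw [h3, e1]
    simp only [Ring.lie_def, add_mul, sub_mul, smul_mul_assoc, smul_add, smul_sub, smul_smul,
      mul_assoc]
    module
  · rw [h5, e3', e1]
    simp only [Ring.lie_def, pd_add, pd_sub, pd_smul, pd_mul, sq, mul_add, mul_sub, add_mul,
      sub_mul, smul_mul_assoc, mul_smul_comm, smul_add, smul_sub, smul_smul, mul_assoc]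
    module

end LinearSystem

end OddKP

theorem theorem3p1 {A : Type*} [Ring A] [Algebra ℚ A]
    (w w' : ℕ → OddKP.OddSeries A) (hw : w 0 = 1) (hw' : w' 0 = 1)
    (bilinear : OddKP.residue (OddKP.psi w) (OddKP.psiTilde w') = 0) :
    -- the functional linear equation, where `F(λ)` is invertible
    (IsUnit (OddKP.F (OddKP.phi w)) ∧
      ∀ n : ℤ, OddKP.FunctionalLinearEquation (OddKP.phi w) (OddKP.thetaTilde w)
        (OddKP.psi w n)) ∧
    -- its expansion in powers of `λ` yields the linear system of the odd KP system
    (∀ φ θt ψ : OddKP.OddSeries A, OddKP.FunctionalLinearEquation φ θt ψ →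
      OddKP.LinearSystemTilde φ θt ψ ∧
      ∀ θ J : OddKP.OddSeries A, OddKP.ThetaRelation φ θt θ J →
        OddKP.LinearSystem φ θ J ψ) := by
  exact ⟨⟨OddKP.isUnit_F _, OddKP.functionalLinearEquation_psi hw hw' bilinear⟩,
    fun _ _ _ h => ⟨OddKP.linearSystemTilde_of_functionalLinearEquation h,
      fun _ _ hθ => (OddKP.linearSystemTilde_of_functionalLinearEquation h).linearSystem hθ⟩⟩
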